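/- Let $M$ be a paracompact Hausdorff smooth manifold of dimension $n$, and let $A$ be a Weil algebra, i.e. a finite-dimensional commutative unital local $\mathbb{R}$-algebra whose maximal ideal $\mathfrak m$ has codimension $1$. Let $M^A$ be the Weil bundle: its points are the morphisms of algebras $\xi:C^\infty(M)\to A$ for which there is $x\in M$ with $\xi(f)-f(x)\in\mathfrak m$ for all $f$. For $f\in C^\infty(M)$ let $f^A:M^A\to A$, $f^A(\xi)=\xi(f)$. Give $M^A$ its usual manifold structure, and let $C^\infty(M^A,A)$ be the algebra of smooth $A$-valued functions on $M^A$, a $C^\infty(M)$-algebra via $f\mapsto f^A$. Vector fields on $M$ are derivations of $C^\infty(M)$; differential forms on $M$ are alternating $C^\infty(M)$-multilinear maps on vector fields, with de Rham differential $d$. Vector fields on $M^A$ are derivations of $C^\infty(M^A)$, extended $A$-linearly to $C^\infty(M^A,A)$ (equivalently, $A$-linear derivations of $C^\infty(M^A,A)$ that send real-valued functions to real-valued functions), with the commutator as bracket. The map $X\mapsto(f\mapsto X(f^A))$ identifies them with the derivations $C^\infty(M)\to C^\infty(M^A,A)$ along $f\mapsto f^A$, which form a $C^\infty(M^A,A)$-module;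 $A$-forms of degree $p$ on $M^A$ are the alternating $C^\infty(M^A,A)$-multilinear maps of degree $p$ from this module into $C^\infty(M^A,A)$, and for an $A$-form $\eta$ of degree $1$ one puts $(d^A\eta)(X,Y)=X(\eta(Y))-Y(\eta(X))-\eta([X,Y])$. Let $\Omega$ be a symplectic form on $M$ and $\theta$ a vector field on $M$. Then: 1. $X\mapsto(f\mapsto X(f^A))$ is a bijection from the vector fields on $M^A$ onto the derivations $C^\infty(M)\to C^\infty(M^A,A)$ along $f\mapsto f^A$. There is exactly one vector field $\theta^A$ on $M^A$ with $\theta^A(f^A)=(\theta f)^A$ for all $f\in C^\infty(M)$, and exactly one $A$-form $\Omega^A$ of degree $2$ on $M^A$ with $\Omega^A(\theta_1^A,\theta_2^A)=(\Omega(\theta_1,\theta_2))^A$ for all vector fields $\theta_1,\theta_2$ on $M$. 2. $\theta$ is locally Hamiltonian, i.e. $d(i_\theta\Omega)=0$, if and only if $\theta^A$ is locally Hamiltonian on $(M^A,\Omega^A)$, i.e. $d^A(i_{\theta^A}\Omega^A)=0$. -/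

import Mathlib

open scoped Manifold ContDiff

noncomputable section

namespace Weil

/-! ### The base manifold -/

section Base

variable (n : ℕ) (M : Type*) [TopologicalSpace M] [ChartedSpace (EuclideanSpace ℝ (Fin n)) M]

/-- The algebra `C^∞(M)` of smooth real functions on an `n`-dimensional manifold `M`. -/
abbrev Smooth : Type _ := C^∞⟮𝓡 n, M; ℝ⟯

/-- Vector fields on `M`, as derivations of `C^∞(M)`. -/
abbrev VField : Type _ := Derivation ℝ (Smooth n M) (Smooth n M)

/-- Differential forms of degree `p` on `M`: alternating `C^∞(M)`-multilinear maps on vector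
fields. -/
abbrev Form (p : ℕ) : Type _ := (VField n M) [⋀^Fin p]→ₗ[Smooth n M] (Smooth n M)

variable {n M}

/-- The de Rham differential of a `1`-form. -/
def d₁ (η : Form n M 1) (X Y : VField n M) : Smooth n M :=
  X (η ![Y]) - Y (η ![X]) - η ![⁅X, Y⁆]

/-- The de Rham differential of a `2`-form. -/
def d₂ (β : Form n M 2) (X Y Z : VField n M) : Smooth n M :=
  X (β ![Y, Z]) - Y (β ![X, Z]) + Z (β ![X, Y])
    - β ![⁅X, Y⁆, Z] + β ![⁅X, Z⁆, Y] - β ![⁅Y, Z⁆, X]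

/-- Symplectic forms: closed `2`-forms that are nondegenerate at every point (a field whose
contraction with `Ω` vanishes at `x` vanishes itself at `x`). -/
structure IsSymplectic (Ω : Form n M 2) : Prop where
  closed : ∀ X Y Z : VField n M, d₂ Ω X Y Z = 0
  nondegenerate : ∀ (x : M) (X : VField n M),
    (∀ Y : VField n M, Ω ![X, Y] x = 0) → ∀ f : Smooth n M, X f x = 0

/-- `θ` is locally Hamiltonian: the `1`-form `i_θ Ω = Ω(θ, ·)` is closed. -/
def IsLocallyHamiltonian (Ω : Form n M 2) (θ : VField n M) : Prop :=
  ∀ X Y : VField n M, d₁ (Ω.curryLeft θ) X Y = 0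

end Base

/-! ### The Weil bundle -/

section Bundle

variable (n : ℕ) (M : Type*) [TopologicalSpace M] [ChartedSpace (EuclideanSpace ℝ (Fin n)) M]
  (A : Type*) [CommRing A] [Algebra ℝ A] [IsLocalRing A]

/-- The Weil bundle `M^A`: the set of near points of kind `A` of the points of `M`. -/
@[ext]
structure NearPoint where
  /-- the near point as a morphism of algebras `C^∞(M) → A` -/
  toAlgHom : Smooth n M →ₐ[ℝ] A
  exists_base : ∃ x : M, ∀ f : Smooth n M,
    toAlgHom f - algebraMap ℝ A (f x) ∈ IsLocalRing.maximalIdeal A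

variable {n M A}

/-- The real functions `ξ ↦ ℓ (f^A(ξ))`, where `f^A(ξ) = ξ(f)` and `ℓ` is a linear form on `A`.
For `f` the coordinates of a chart of `M` and `ℓ` the coordinates on `A` these are the coordinates
of the associated chart of `M^A`. -/
def coordFun (f : Smooth n M) (l : A →ₗ[ℝ] ℝ) (ξ : NearPoint n M A) : ℝ := l (ξ.toAlgHom f)

/-- The manifold topology of `M^A`: the coarsest one for which all functions `f^A` are
continuous. -/
instance : TopologicalSpace (NearPoint n M A) :=
  ⨅ (f : Smooth n M) (l : A →ₗ[ℝ] ℝ), TopologicalSpace.induced (coordFun f l) inferInstance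

/-- Smoothness of a real function on `M^A`: locally it is a smooth function of finitely many of the
functions `coordFun f l`. Since the charts of `M^A` consist of such functions, and all such
functions are smooth in these charts, this is smoothness for the manifold structure of `M^A`. -/
def IsSmoothReal (φ : NearPoint n M A → ℝ) : Prop :=
  ∀ ξ : NearPoint n M A, ∃ U : Set (NearPoint n M A), IsOpen U ∧ ξ ∈ U ∧
    ∃ (k : ℕ) (f : Fin k → Smooth n M) (l : Fin k → A →ₗ[ℝ] ℝ) (g : (Fin k → ℝ) → ℝ),
      ContDiff ℝ ∞ g ∧ ∀ ζ ∈ U, φ ζ = g (fun i => coordFun (f i) (l i) ζ)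

theorem isSmoothReal_coordFun (f : Smooth n M) (l : A →ₗ[ℝ] ℝ) :
    IsSmoothReal (coordFun f l : NearPoint n M A → ℝ) := fun _ =>
  ⟨Set.univ, isOpen_univ, trivial, 1, fun _ => f, fun _ => l, fun v => v 0,
    contDiff_apply ℝ ℝ 0, fun _ _ => rfl⟩

theorem isSmoothReal_const (c : ℝ) : IsSmoothReal (fun _ : NearPoint n M A => c) := fun _ =>
  ⟨Set.univ, isOpen_univ, trivial, 0, Fin.elim0, Fin.elim0, fun _ => c,
    contDiff_const, fun _ _ => rfl⟩

theorem IsSmoothReal.comp₂ {φ ψ : NearPoint n M A → ℝ} (hφ : IsSmoothReal φ)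
    (hψ : IsSmoothReal ψ) {G : ℝ → ℝ → ℝ} (hG : ContDiff ℝ ∞ (fun p : ℝ × ℝ => G p.1 p.2)) :
    IsSmoothReal (fun ζ => G (φ ζ) (ψ ζ)) := by
  intro ξ
  obtain ⟨U, hU, hξU, k, f, l, g, hg, h⟩ := hφ ξ
  obtain ⟨U', hU', hξU', k', f', l', g', hg', h'⟩ := hψ ξ
  refine ⟨U ∩ U', hU.inter hU', ⟨hξU, hξU'⟩, k + k', Fin.append f f', Fin.append l l',
    fun v => G (g fun i => v (Fin.castAdd k' i)) (g' fun i => v (Fin.natAdd k i)), ?_, ?_⟩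
  · have h1 : ContDiff ℝ ∞ (fun v : Fin (k + k') → ℝ => g fun i => v (Fin.castAdd k' i)) :=
      hg.comp (contDiff_pi.2 fun i => contDiff_apply ℝ ℝ _)
    have h2 : ContDiff ℝ ∞ (fun v : Fin (k + k') → ℝ => g' fun i => v (Fin.natAdd k i)) :=
      hg'.comp (contDiff_pi.2 fun i => contDiff_apply ℝ ℝ _)
    exact hG.comp (h1.prodMk h2)
  · intro ζ hζ
    simp only [Fin.append_left, Fin.append_right]
    rw [h ζ hζ.1, h' ζ hζ.2]

theorem IsSmoothReal.add {φ ψ : NearPoint n M A → ℝ} (hφ : IsSmoothReal φ)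
    (hψ : IsSmoothReal ψ) : IsSmoothReal (fun ζ => φ ζ + ψ ζ) :=
  hφ.comp₂ hψ (G := fun a b => a + b) (contDiff_fst.add contDiff_snd)

theorem IsSmoothReal.mul {φ ψ : NearPoint n M A → ℝ} (hφ : IsSmoothReal φ)
    (hψ : IsSmoothReal ψ) : IsSmoothReal (fun ζ => φ ζ * ψ ζ) :=
  hφ.comp₂ hψ (G := fun a b => a * b) (contDiff_fst.mul contDiff_snd)

theorem IsSmoothReal.sum {ι : Type*} (s : Finset ι) {φ : ι → NearPoint n M A → ℝ}
    (h : ∀ i, IsSmoothReal (φ i)) : IsSmoothReal (fun ζ => ∑ i ∈ s, φ i ζ) := by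
  classical
  induction s using Finset.induction_on with
  | empty => simpa using isSmoothReal_const (n := n) (M := M) (A := A) 0
  | insert a s ha ih => simpa [Finset.sum_insert ha] using (h a).add ih

variable (n M A) [Module.Finite ℝ A]

/-- The `A`-algebra `C^∞(M^A, A)` of smooth functions on `M^A` with values in `A`. -/
def smoothAlg : Subalgebra A (NearPoint n M A → A) where
  carrier := {φ | ∀ l : A →ₗ[ℝ] ℝ, IsSmoothReal (fun ξ => l (φ ξ))}
  mul_mem' := by
    intro φ ψ hφ hψ l
    let b := Module.finBasis ℝ A
    have key : (fun ξ => l ((φ * ψ) ξ)) = fun ξ =>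
        ∑ i, ∑ j, (b.coord i (φ ξ) * b.coord j (ψ ξ)) * l (b i * b j) := by
      funext ξ
      have e : (φ * ψ) ξ = ∑ i, ∑ j, (b.coord i (φ ξ) * b.coord j (ψ ξ)) • (b i * b j) := by
        conv_lhs => rw [Pi.mul_apply, ← b.sum_repr (φ ξ), ← b.sum_repr (ψ ξ), Finset.sum_mul_sum]
        simp only [smul_mul_smul_comm, Module.Basis.coord_apply]
      rw [e]
      simp
    rw [key]
    exact IsSmoothReal.sum _ fun i => IsSmoothReal.sum _ fun j =>
      ((hφ _).mul (hψ _)).mul (isSmoothReal_const _)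
  add_mem' := by
    intro φ ψ hφ hψ l
    simpa using (hφ l).add (hψ l)
  algebraMap_mem' := fun a l => isSmoothReal_const (l a)

/-- `C^∞(M^A, A)` as a type. -/
abbrev SmoothA : Type _ := smoothAlg n M A

/-- The morphism of algebras `C^∞(M) → C^∞(M^A, A)`, `f ↦ f^A`, with `f^A(ξ) = ξ(f)`. -/
def prolong : Smooth n M →ₐ[ℝ] SmoothA n M A where
  toFun f := ⟨fun ξ => ξ.toAlgHom f, fun l => isSmoothReal_coordFun f l⟩
  map_one' := Subtype.ext (funext fun ξ => map_one ξ.toAlgHom)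
  map_mul' f g := Subtype.ext (funext fun ξ => map_mul ξ.toAlgHom f g)
  map_zero' := Subtype.ext (funext fun ξ => map_zero ξ.toAlgHom)
  map_add' f g := Subtype.ext (funext fun ξ => map_add ξ.toAlgHom f g)
  commutes' r := Subtype.ext (funext fun ξ => ξ.toAlgHom.commutes r)

/-- `C^∞(M^A, A)` is a `C^∞(M)`-algebra through `f ↦ f^A`. -/
instance : Algebra (Smooth n M) (SmoothA n M A) := (prolong n M A).toRingHom.toAlgebra

/-- Derivations `X : C^∞(M) → C^∞(M^A, A)` along `f ↦ f^A`, that is, maps with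
`X(fg) = X(f) g^A + f^A X(g)`. They form a `C^∞(M^A, A)`-module. -/
abbrev VFieldAlong : Type _ := Derivation ℝ (Smooth n M) (SmoothA n M A)

variable {n M A} in
/-- The functions in `C^∞(M^A, A)` with real values, i.e. the elements of `C^∞(M^A)`. -/
def IsRealValued (φ : SmoothA n M A) : Prop :=
  ∀ ξ : NearPoint n M A, φ.1 ξ ∈ Set.range (algebraMap ℝ A)

/-- Vector fields on `M^A`: derivations of `C^∞(M^A)`, extended `A`-linearly to `C^∞(M^A, A)`;
equivalently, `A`-linear derivations of `C^∞(M^A, A)` that send real functions to real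
functions. -/
abbrev VFieldA : Type _ :=
  {X : Derivation A (SmoothA n M A) (SmoothA n M A) //
    ∀ φ : SmoothA n M A, IsRealValued φ → IsRealValued (X φ)}

variable {n M A}

/-- The commutator of vector fields on `M^A`. -/
instance : Bracket (VFieldA n M A) (VFieldA n M A) where
  bracket X Y := ⟨⁅X.1, Y.1⁆, fun φ hφ ξ => by
    obtain ⟨r, hr⟩ := X.2 _ (Y.2 _ hφ) ξ
    obtain ⟨s, hs⟩ := Y.2 _ (X.2 _ hφ) ξ
    refine ⟨r - s, ?_⟩
    rw [map_sub, hr, hs, Derivation.commutator_apply]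
    rfl⟩

/-- A vector field `X` on `M^A`, seen as the derivation `f ↦ X(f^A)` of `C^∞(M)` into
`C^∞(M^A, A)`. -/
def VFieldA.along (X : VFieldA n M A) : VFieldAlong n M A :=
  Derivation.mk' ((X.1.restrictScalars ℝ).toLinearMap ∘ₗ (prolong n M A).toLinearMap)
    fun f g => by
      change X.1 (prolong n M A (f * g)) = prolong n M A f * X.1 (prolong n M A g)
        + prolong n M A g * X.1 (prolong n M A f)
      rw [map_mul, Derivation.leibniz]
      rfl

variable (n M A) in
/-- Differential `A`-forms of degree `p` on `M^A`: alternating `C^∞(M^A, A)`-multilinear maps on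
the `C^∞(M^A, A)`-module of vector fields on `M^A`. The module structure on vector fields, for
which `φ • X` sends `f^A` to `φ · X(f^A)`, is that of the derivations `C^∞(M) → C^∞(M^A, A)`. -/
abbrev FormA (p : ℕ) : Type _ :=
  (VFieldAlong n M A) [⋀^Fin p]→ₗ[SmoothA n M A] (SmoothA n M A)

/-- The differential `d^A` of an `A`-form of degree `1`. -/
def dA₁ (η : FormA n M A 1) (X Y : VFieldA n M A) : SmoothA n M A :=
  X.1 (η ![Y.along]) - Y.1 (η ![X.along]) - η ![(⁅X, Y⁆ : VFieldA n M A).along]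

/-- The derivation `f ↦ (θ f)^A` of `C^∞(M)` into `C^∞(M^A, A)`. -/
def prolongAlong (A : Type*) [CommRing A] [Algebra ℝ A] [IsLocalRing A] [Module.Finite ℝ A]
    (θ : VField n M) : VFieldAlong n M A :=
  Derivation.mk' ((prolong n M A).toLinearMap ∘ₗ θ.toLinearMap) fun f g => by
    change prolong n M A (θ (f * g)) = prolong n M A f * prolong n M A (θ g)
      + prolong n M A g * prolong n M A (θ f)
    rw [Derivation.leibniz, smul_eq_mul, smul_eq_mul, map_add, map_mul, map_mul]

/-- `Θ` is the prolongation `θ^A` of the vector field `θ`: `Θ(f^A) = (θ f)^A` for all `f`. -/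
def IsFieldProlongation (θ : VField n M) (Θ : VFieldA n M A) : Prop :=
  ∀ f : Smooth n M, Θ.1 (prolong n M A f) = prolong n M A (θ f)

/-- `ΩA` is the prolongation `Ω^A` of the form `Ω`:
`ΩA(θ₁^A, …, θₚ^A) = (Ω(θ₁, …, θₚ))^A` for all vector fields `θᵢ` on `M`. -/
def IsFormProlongation {p : ℕ} (Ω : Form n M p) (ΩA : FormA n M A p) : Prop :=
  ∀ θ : Fin p → VField n M, ΩA (fun i => prolongAlong A (θ i)) = prolong n M A (Ω θ)

/-- The vector field `X` on `M^A` is locally Hamiltonian: the `A`-form `i_X ΩA = ΩA(X, ·)` is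
`d^A`-closed. -/
def IsLocallyHamiltonianA (ΩA : FormA n M A 2) (X : VFieldA n M A) : Prop :=
  ∀ Y Z : VFieldA n M A, dA₁ (ΩA.curryLeft X.along) Y Z = 0

end Bundle

end Weil

end

open scoped Manifold ContDiff

noncomputable section

namespace Weil

/-! ### Hadamard's lemma -/

section Hadamard

open MeasureTheory

/-! Everything reduces to local coordinates x_i. Near y, Hadamard's lemma writes f = f(y) + Σ (x_i −
x_i(y)) g_i. For a near point ξ over y the elements ξ(x_i) − x_i(y) lie in 𝔪, so Nakayama's lemma
shows that ξ, and every derivation along ξ, is determined by its values on the x_i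
(`LocalFrame.algHom_ext`, `LocalFrame.deriv_ext`). Bump functions make this usable on M, whose forms
and fields are only given globally.

Vector fields on M^A correspond to derivations D along f ↦ f^A. Injectivity: a field killing all f^A
kills their real coordinates, because it preserves real values and a basis of A is linearly
independent over ℝ; by Hadamard it then kills all smooth functions. Surjectivity: each value D_ξ is
the velocity of a curve of near points (`NearPoint.exists_curve`), and differentiation along these
curves defines the field. The curve combines a curve in M, carrying the real parts of the D(x_i),
with translations exp(mX), m ∈ 𝔪, along coordinate fields, carrying the nilpotent parts; since m is
nilpotent the exponential is a finite sum.

For Ω, the expression Σ D(x_i) D'(x_j) ξ(Ω(∂_i, ∂_j)) does not depend on the frame and defines Ω^A.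
It is unique because the prolonged fields ∂_i^A locally span the derivations along f ↦ f^A.

For part 2, i_{θ^A} Ω^A is the prolongation of α = i_θ Ω. On prolonged fields, d^A of it is the
prolongation of dα, and f ↦ f^A is injective, so closedness descends. Conversely, with a_i = α(∂_i),
the value of d^A on arbitrary fields is a local sum with coefficients (∂_j a_i − ∂_i a_j)^A, which
vanish when dα = 0 (`dA₁_eq_zero`). -/

theorem exists_smooth_slope {E : Type*} [NormedAddCommGroup E] [NormedSpace ℝ E]
    {F : E → ℝ} (hF : ContDiff ℝ ∞ F) (c : E) :
    ∃ G : E → E →L[ℝ] ℝ, ContDiff ℝ ∞ G ∧ ∀ v, F v = F c + G v (v - c) := by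
  have hF' : ContDiff ℝ ∞ (fderiv ℝ F) := hF.fderiv_right (by simp)
  -- The slope is G(p) = ∫₀¹ dF(c + s(p − c)) ds. It is written as the value at 1 of the convolution
  -- of the indicator of (0, 1] with a kernel in s, so that smoothness in p follows from smoothness
  -- of convolutions with parameters. The bump, equal to 1 on [−1, 1], gives the kernel compact
  -- support without changing the integral.
  let b : ContDiffBump (0 : ℝ) := ⟨1, 2, one_pos, one_lt_two⟩
  let g : E → ℝ → E →L[ℝ] ℝ := fun p s => b s • fderiv ℝ F (c + s • (p - c))
  let f : ℝ → ℝ := (Set.Ioc (0 : ℝ) 1).indicator fun _ => 1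
  have hg : ContDiff ℝ ∞ ↿g := by
    change ContDiff ℝ ∞ fun q : E × ℝ => b q.2 • fderiv ℝ F (c + q.2 • (q.1 - c))
    refine (b.contDiff.comp contDiff_snd).smul (hF'.comp ?_)
    exact contDiff_const.add (contDiff_snd.smul (contDiff_fst.sub contDiff_const))
  have hf : LocallyIntegrable f volume :=
    ((integrable_indicator_iff measurableSet_Ioc).2 (by simp)).locallyIntegrable
  have key := contDiffOn_convolution_right_with_param (μ := volume) (n := ⊤)
    (ContinuousLinearMap.lsmul ℝ ℝ) (f := f) (g := g) (s := Set.univ)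
    (k := Metric.closedBall 0 2) isOpen_univ (isCompact_closedBall _ _)
    (by
      intro p x _ hx
      have : b x = 0 := b.zero_of_le_dist (by
        simpa [b] using (lt_of_not_ge fun h => hx (by simpa using h)).le)
      simp [g, this]) hf hg.contDiffOn
  rw [Set.univ_prod_univ, contDiffOn_univ] at key
  refine ⟨_, key.comp (contDiff_id.prodMk (contDiff_const (c := (1 : ℝ)))), fun v => ?_⟩
  have hGv : (convolution f (g v) (ContinuousLinearMap.lsmul ℝ ℝ) volume) 1
      = ∫ t in (0 : ℝ)..1, fderiv ℝ F (c + (1 - t) • (v - c)) := by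
    rw [intervalIntegral.integral_of_le zero_le_one, ← integral_indicator measurableSet_Ioc]
    refine integral_congr_ae (Filter.Eventually.of_forall fun t => ?_)
    by_cases ht : t ∈ Set.Ioc (0 : ℝ) 1
    · have : b (1 - t) = 1 := b.one_of_mem_closedBall (by
        rw [Metric.mem_closedBall, Real.dist_eq, abs_le]
        constructor <;> linarith [ht.1, ht.2])
      simp [f, g, ht, this]
    · simp [f, ht]
  have hc : Continuous fun t : ℝ => fderiv ℝ F (c + (1 - t) • (v - c)) :=
    hF'.continuous.comp (by fun_prop)
  have hint : ∫ t in (0 : ℝ)..1, fderiv ℝ F (c + (1 - t) • (v - c)) (v - c) = F v - F c := by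
    have := intervalIntegral.integral_eq_sub_of_hasDerivAt (a := 0) (b := 1)
      (f := fun t : ℝ => - F (c + (1 - t) • (v - c)))
      (f' := fun t : ℝ => fderiv ℝ F (c + (1 - t) • (v - c)) (v - c))
      (fun t _ => by
        have h1 : HasDerivAt (fun t : ℝ => c + (1 - t) • (v - c)) (-(v - c)) t := by
          simpa using (((hasDerivAt_id t).const_sub 1).smul_const (v - c)).const_add c
        have h2 := ((hF.differentiable (by simp) _).hasFDerivAt.comp_hasDerivAt t h1).neg
        rw [map_neg, neg_neg] at h2
        exact h2)
      ((hc.clm_apply continuous_const).intervalIntegrable _ _)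
    rw [this]
    simp only [sub_self, zero_smul, add_zero, sub_zero, one_smul, add_sub_cancel]
    ring
  change F v = F c + (convolution f (g v) (ContinuousLinearMap.lsmul ℝ ℝ) volume) 1 (v - c)
  rw [hGv, ContinuousLinearMap.intervalIntegral_apply (hc.intervalIntegrable _ _), hint]
  ring

end Hadamard

/-! ### Bump functions and local frames -/

section LocalFrame

open Filter Topology

variable {n : ℕ} {M : Type*} [TopologicalSpace M] [ChartedSpace (EuclideanSpace ℝ (Fin n)) M]

/-- Both conclusions concern germs: a near point over z sees only the germ of σ at z. -/
theorem exists_bump [IsManifold (𝓡 n) ∞ M] [T2Space M] {U : Set M} {x : M} (hU : U ∈ 𝓝 x) :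
    ∃ σ : Smooth n M, (∀ᶠ z in 𝓝 x, σ z = 1) ∧ ∀ z ∉ U, ∀ᶠ w in 𝓝 z, σ w = 0 := by
  obtain ⟨b, -, hb⟩ := (SmoothBumpFunction.nhds_basis_tsupport (I := 𝓡 n) x).mem_iff.1 hU
  exact ⟨⟨b, b.contMDiff⟩, b.eventuallyEq_one,
    fun z hz => notMem_tsupport_iff_eventuallyEq.1 fun h => hz (hb h)⟩

/-- Functions and vector fields on `M` that restrict to the coordinates and the coordinate fields
of a chart on a neighbourhood `U` of `x₀`. -/
structure LocalFrame (n : ℕ) {M : Type*} [TopologicalSpace M]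
    [ChartedSpace (EuclideanSpace ℝ (Fin n)) M] (x₀ : M) where
  /-- the neighbourhood on which the frame is defined -/
  U : Set M
  isOpen_U : IsOpen U
  mem_U : x₀ ∈ U
  /-- the coordinate functions -/
  coord : Fin n → Smooth n M
  /-- the coordinate vector fields -/
  field : Fin n → VField n M
  field_coord : ∀ y ∈ U, ∀ i j, field i (coord j) y = if i = j then 1 else 0
  slope : ∀ y ∈ U, ∀ f : Smooth n M, ∃ g : Fin n → Smooth n M,
    ∀ᶠ z in 𝓝 y, f z = f y + ∑ i, (coord i z - coord i y) * g i z
  curve : ∀ y ∈ U, ∀ r : Fin n → ℝ, ∃ c : ℝ → M, c 0 = y ∧ ContinuousAt c 0 ∧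
    (∀ f : Smooth n M, DifferentiableAt ℝ (fun t => f (c t)) 0) ∧
    ∀ i, HasDerivAt (fun t => coord i (c t)) (r i) 0

variable [IsManifold (𝓡 n) ∞ M]

theorem contDiffOn_comp_extChartAt_symm (x₀ : M) (f : Smooth n M) :
    ContDiffOn ℝ ∞ (fun v => f ((extChartAt (𝓡 n) x₀).symm v)) (extChartAt (𝓡 n) x₀).target :=
  contMDiffOn_iff_contDiffOn.1
    (f.contMDiff.comp_contMDiffOn (contMDiffOn_extChartAt_symm (I := 𝓡 n) (n := ∞) x₀))

theorem differentiableAt_comp_extChartAt_symm (x₀ : M) (f : Smooth n M) {v}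
    (hv : v ∈ (extChartAt (𝓡 n) x₀).target) :
    DifferentiableAt ℝ (fun v => f ((extChartAt (𝓡 n) x₀).symm v)) v :=
  ((contDiffOn_comp_extChartAt_symm x₀ f).contDiffAt
    ((isOpen_extChartAt_target x₀).mem_nhds hv)).differentiableAt (by simp)

theorem contMDiffOn_extChartAt_source (x₀ : M) :
    ContMDiffOn (𝓡 n) 𝓘(ℝ, EuclideanSpace ℝ (Fin n)) ∞ (extChartAt (𝓡 n) x₀)
      (chartAt (EuclideanSpace ℝ (Fin n)) x₀).source :=
  contMDiffOn_extChartAt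

variable [T2Space M]

/-- The function `b ∂f/∂v` for a bump function `b` in a chart. -/
def bumpDeriv {x₀ : M} (b : SmoothBumpFunction (𝓡 n) x₀) (v : EuclideanSpace ℝ (Fin n))
    (f : Smooth n M) : Smooth n M :=
  ⟨fun y => b y • fderiv ℝ (fun w => f ((extChartAt (𝓡 n) x₀).symm w))
      (extChartAt (𝓡 n) x₀ y) v, by
    refine b.contMDiff_smul ?_
    have h1 : ContDiffOn ℝ ∞ (fun w => fderiv ℝ
        (fun w => f ((extChartAt (𝓡 n) x₀).symm w)) w v) (extChartAt (𝓡 n) x₀).target :=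
      ((contDiffOn_comp_extChartAt_symm x₀ f).fderiv_of_isOpen
        (isOpen_extChartAt_target x₀) (by simp)).clm_apply contDiffOn_const
    refine (contMDiffOn_iff_contDiffOn.2 h1).comp (contMDiffOn_extChartAt_source x₀) ?_
    intro y hy
    exact (extChartAt (𝓡 n) x₀).map_source (by rwa [extChartAt_source])⟩

theorem bumpDeriv_apply {x₀ : M} (b : SmoothBumpFunction (𝓡 n) x₀)
    (v : EuclideanSpace ℝ (Fin n)) (f : Smooth n M) (y : M) :
    bumpDeriv b v f y = b y * fderiv ℝ
      (fun w => f ((extChartAt (𝓡 n) x₀).symm w)) (extChartAt (𝓡 n) x₀ y) v := rfl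

/-- The vector field `b ∂/∂v` for a bump function `b` in a chart. -/
def bumpField {x₀ : M} (b : SmoothBumpFunction (𝓡 n) x₀) (v : EuclideanSpace ℝ (Fin n)) :
    VField n M :=
  Derivation.mk'
    { toFun := bumpDeriv b v
      map_add' := fun f g => by
        ext y
        change bumpDeriv b v (f + g) y = bumpDeriv b v f y + bumpDeriv b v g y
        simp only [bumpDeriv_apply]
        by_cases hy : y ∈ (chartAt (EuclideanSpace ℝ (Fin n)) x₀).source
        · have hv : extChartAt (𝓡 n) x₀ y ∈ (extChartAt (𝓡 n) x₀).target :=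
            (extChartAt (𝓡 n) x₀).map_source (by rwa [extChartAt_source])
          have := congrArg (· v) (fderiv_fun_add (differentiableAt_comp_extChartAt_symm x₀ f hv)
            (differentiableAt_comp_extChartAt_symm x₀ g hv))
          rw [← mul_add]
          exact congrArg (b y * ·) this
        · have : b y = 0 := Function.notMem_support.1 fun h => hy (b.support_subset_source h)
          simp [this]
      map_smul' := fun c f => by
        ext y
        change bumpDeriv b v (c • f) y = c * bumpDeriv b v f y
        simp only [bumpDeriv_apply]
        rw [mul_left_comm]
        exact congrArg (b y * ·) (congrArg (· v) (congrFun (fderiv_const_smul_field (𝕜 := ℝ)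
          (f := fun w => f ((extChartAt (𝓡 n) x₀).symm w)) c) (extChartAt (𝓡 n) x₀ y))) }
    fun f g => by
      ext y
      change bumpDeriv b v (f * g) y = f y * bumpDeriv b v g y + g y * bumpDeriv b v f y
      simp only [bumpDeriv_apply]
      by_cases hy : y ∈ (chartAt (EuclideanSpace ℝ (Fin n)) x₀).source
      · have hy' : y ∈ (extChartAt (𝓡 n) x₀).source := by rwa [extChartAt_source]
        have hv := (extChartAt (𝓡 n) x₀).map_source hy'
        have := congrArg (· v) (fderiv_fun_mul (differentiableAt_comp_extChartAt_symm x₀ f hv)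
          (differentiableAt_comp_extChartAt_symm x₀ g hv))
        simp only [(extChartAt (𝓡 n) x₀).left_inv hy'] at this
        refine (congrArg (b y * ·) this).trans ?_
        simp only [add_apply, smul_apply, smul_eq_mul]
        ring
      · have : b y = 0 := Function.notMem_support.1 fun h => hy (b.support_subset_source h)
        simp [this]

theorem bumpField_apply {x₀ : M} (b : SmoothBumpFunction (𝓡 n) x₀)
    (v : EuclideanSpace ℝ (Fin n)) (f : Smooth n M) (y : M) :
    bumpField b v f y = b y * fderiv ℝ
      (fun w => f ((extChartAt (𝓡 n) x₀).symm w)) (extChartAt (𝓡 n) x₀ y) v := rfl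

theorem exists_smooth_slope_extChartAt {x₀ : M} (b : SmoothBumpFunction (𝓡 n) x₀) {y : M}
    (hy : y ∈ (extChartAt (𝓡 n) x₀).source) (hb : ∀ᶠ z in 𝓝 y, b z = 1) (f : Smooth n M) :
    ∃ g : Fin n → Smooth n M, ∀ᶠ z in 𝓝 y,
      f z = f y + ∑ i, (extChartAt (𝓡 n) x₀ z i - extChartAt (𝓡 n) x₀ y i) * g i z := by
  set ψ := extChartAt (𝓡 n) x₀ with hψ
  have hv : ψ y ∈ ψ.target := ψ.map_source hy
  have hT : ψ.target ∈ 𝓝 (ψ y) := (isOpen_extChartAt_target x₀).mem_nhds hv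
  obtain ⟨ρ, hρs⟩ : ∃ ρ : ContDiffBump (ψ y), tsupport ρ ⊆ ψ.target := by
    obtain ⟨ε, hε, h⟩ := Metric.nhds_basis_closedBall.mem_iff.1 hT
    refine ⟨⟨ε / 2, ε, by positivity, by linarith⟩, ?_⟩
    rw [ContDiffBump.tsupport_eq]
    exact h
  -- Hadamard's lemma needs a function smooth on the whole space; the cutoff ρ extends the local
  -- expression of f by zero without changing its germ at ψ y.
  let F : EuclideanSpace ℝ (Fin n) → ℝ := fun w => ρ w * f (ψ.symm w)
  have hF : ContDiff ℝ ∞ F := by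
    rw [contDiff_iff_contDiffAt]
    intro w
    by_cases hw : w ∈ ψ.target
    · exact ρ.contDiff.contDiffAt.mul ((contDiffOn_comp_extChartAt_symm x₀ f).contDiffAt
        ((isOpen_extChartAt_target x₀).mem_nhds hw))
    · have h0 : ∀ᶠ u in 𝓝 w, ρ u = 0 := by
        have := notMem_tsupport_iff_eventuallyEq.1 fun h => hw (hρs h)
        exact this
      refine (contDiffAt_const (c := (0 : ℝ))).congr_of_eventuallyEq ?_
      filter_upwards [h0] with u hu
      simp [F, hu]
  obtain ⟨G, hG, hGF⟩ := exists_smooth_slope hF (ψ y)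
  have hFf : ∀ᶠ z in 𝓝 y, F (ψ z) = f z := by
    have h1 : ∀ᶠ z in 𝓝 y, ρ (ψ z) = 1 :=
      (continuousAt_extChartAt' hy).eventually ρ.eventuallyEq_one
    filter_upwards [h1, (isOpen_extChartAt_source x₀).mem_nhds hy] with z hz hz'
    simp only [F, hz, ψ.left_inv hz', one_mul]
  refine ⟨fun i => ⟨fun z => b z • G (ψ z) (EuclideanSpace.single i 1), ?_⟩, ?_⟩
  · refine b.contMDiff_smul ?_
    exact (hG.clm_apply contDiff_const).contMDiff.comp_contMDiffOn
      (contMDiffOn_extChartAt_source x₀)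
  · filter_upwards [hFf, hb] with z hz hbz
    have := hGF (ψ z)
    rw [hz, hFf.self_of_nhds] at this
    rw [this]
    congr 1
    have hsum : ψ z - ψ y = ∑ i, (ψ z i - ψ y i) • EuclideanSpace.single i (1 : ℝ) := by
      ext j
      simp [Finset.sum_apply, Pi.single_apply]
    change _ = ∑ i, (ψ z i - ψ y i) * (b z • G (ψ z) (EuclideanSpace.single i 1))
    conv_lhs => rw [hsum]
    rw [map_sum]
    simp [hbz]

theorem nonempty_localFrame (x₀ : M) : Nonempty (LocalFrame n x₀) := by
  obtain ⟨b⟩ : Nonempty (SmoothBumpFunction (𝓡 n) x₀) := inferInstance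
  set ψ := extChartAt (𝓡 n) x₀ with hψ
  let X : Fin n → Smooth n M := fun i => ⟨fun y => b y • ψ y i, by
    refine b.contMDiff_smul ?_
    exact (contDiff_euclidean.1 contDiff_id i).contMDiff.comp_contMDiffOn
      (contMDiffOn_extChartAt_source x₀)⟩
  have hX : ∀ i y, X i y = b y * ψ y i := fun i y => rfl
  have hXψ : ∀ y, (∀ᶠ z in 𝓝 y, b z = 1) → ∀ᶠ z in 𝓝 y, ∀ i, X i z = ψ z i := by
    intro y hy
    filter_upwards [hy] with z hz i
    rw [hX, hz, one_mul]
  have hback : ∀ y ∈ ψ.source, ∀ P : M → Prop, (∀ᶠ z in 𝓝 y, P z) →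
      ∀ᶠ w in 𝓝 (ψ y), P (ψ.symm w) ∧ w ∈ ψ.target := by
    intro y hy P hP
    have h1 := continuousAt_extChartAt_symm' (I := 𝓡 n) hy
    rw [ContinuousAt, ← hψ, ψ.left_inv hy] at h1
    exact (h1.eventually hP).and ((isOpen_extChartAt_target x₀).mem_nhds (ψ.map_source hy))
  exact ⟨{
    -- On this open set the cut-off coordinates b x_i and fields b ∂_i have the germs of the true
    -- ones.
    U := {y | ∀ᶠ z in 𝓝 y, b z = 1} ∩ ψ.source
    isOpen_U := isOpen_setOfPred_eventually_nhds.inter (isOpen_extChartAt_source x₀)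
    mem_U := ⟨b.eventuallyEq_one, mem_extChartAt_source x₀⟩
    coord := X
    field := fun i => bumpField b (EuclideanSpace.single i 1)
    field_coord := by
      rintro y ⟨hby, hy⟩ i j
      rw [bumpField_apply, hby.self_of_nhds, one_mul]
      have h1 : (fun w => X j (ψ.symm w)) =ᶠ[𝓝 (ψ y)] EuclideanSpace.proj j := by
        filter_upwards [hback y hy _ (hXψ y hby)] with w hw
        rw [hw.1 j, ψ.right_inv hw.2]
        rfl
      rw [h1.fderiv_eq, ContinuousLinearMap.fderiv]
      simp [eq_comm]
    slope := by
      rintro y ⟨hby, hy⟩ f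
      obtain ⟨g, hg⟩ := exists_smooth_slope_extChartAt b hy hby f
      refine ⟨g, ?_⟩
      filter_upwards [hg, hXψ y hby] with z hz hz'
      simp only [hz', (hXψ y hby).self_of_nhds]
      exact hz
    curve := by
      rintro y ⟨hby, hy⟩ r
      -- The curve is a straight line in the chart with velocity r.
      let L : ℝ → EuclideanSpace ℝ (Fin n) := fun t => ψ y + t • WithLp.toLp 2 r
      have hL0 : L 0 = ψ y := by simp [L]
      have hL : HasDerivAt L (WithLp.toLp 2 r) 0 := by
        have := ((hasDerivAt_id (0 : ℝ)).smul_const (WithLp.toLp 2 r)).const_add (ψ y)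
        rw [one_smul] at this
        exact this
      have hLc : Tendsto L (𝓝 0) (𝓝 (ψ y)) := hL0 ▸ hL.continuousAt
      refine ⟨fun t => ψ.symm (L t), ?_, ?_, ?_, ?_⟩
      · simp only [hL0, ψ.left_inv hy]
      · have h1 := continuousAt_extChartAt_symm' (I := 𝓡 n) hy
        rw [← hL0] at h1
        exact ContinuousAt.comp (f := L) h1 hL.continuousAt
      · intro f
        have h1 := differentiableAt_comp_extChartAt_symm x₀ f (ψ.map_source hy)
        rw [← hψ, ← hL0] at h1
        exact h1.comp 0 hL.differentiableAt
      · intro i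
        have h1 : HasDerivAt (fun t => L t i) (r i) 0 :=
          (EuclideanSpace.proj (𝕜 := ℝ) i).hasFDerivAt.comp_hasDerivAt (0 : ℝ) hL
        refine h1.congr_of_eventuallyEq ?_
        filter_upwards [hLc.eventually (hback y hy _ (hXψ y hby))] with t ht
        rw [ht.1 i, ψ.right_inv ht.2] }⟩

end LocalFrame

/-! ### Algebra of near points -/

section NearAlgebra

open Filter Topology IsLocalRing

/-! ### Nakayama's lemma, nilpotency and the augmentation of a Weil algebra. -/

section WeilAlgebra

variable {A : Type*} [CommRing A] [Algebra ℝ A] [Module.Finite ℝ A] [IsLocalRing A]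

omit [Algebra ℝ A] [Module.Finite ℝ A] in
-- Nakayama's lemma for the span N of the family: the hypothesis says N ⊆ 𝔪N, and N is finitely
-- generated. It is applied to the values of a derivation and to the differences of two near points.
theorem eq_zero_of_mem_maximalIdeal_smul_span [IsNoetherianRing A] {ι : Type*} (u : ι → A)
    (h : ∀ i, u i ∈ maximalIdeal A • Submodule.span A (Set.range u)) (i : ι) : u i = 0 := by
  have hN : Submodule.span A (Set.range u) = ⊥ :=
    Submodule.eq_bot_of_le_smul_of_le_jacobson_bot (maximalIdeal A) _ (IsNoetherian.noetherian _)
      (Submodule.span_le.2 (by rintro _ ⟨i, rfl⟩; exact h i))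
      (jacobson_eq_maximalIdeal ⊥ bot_ne_top).ge
  exact (Submodule.mem_bot A).1 (hN ▸ Submodule.subset_span ⟨i, rfl⟩)

omit [IsLocalRing A] in
variable (A) in
theorem isNoetherianRing_of_finite : IsNoetherianRing A :=
  isNoetherian_of_tower ℝ inferInstance

variable (A) in
-- The exponent N + 2, rather than N, guarantees that the truncated exponential contains its terms
-- of order 0 and 1.
theorem exists_pow_eq_zero : ∃ N : ℕ, ∀ m ∈ maximalIdeal A, m ^ (N + 2) = 0 := by
  have := IsArtinianRing.of_finite ℝ A
  obtain ⟨N, hN⟩ := IsArtinianRing.isNilpotent_jacobson_bot (R := A)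
  rw [jacobson_eq_maximalIdeal ⊥ bot_ne_top] at hN
  refine ⟨N, fun m hm => ?_⟩
  have h : m ^ N ∈ maximalIdeal A ^ N := Ideal.pow_mem_pow hm N
  rw [hN] at h
  rw [pow_add, (Submodule.mem_bot A).1 h, zero_mul]

omit [Module.Finite ℝ A] in
-- Codimension 1 identifies A/𝔪 with ℝ; the projection gives the real part of an element of A.
theorem exists_augmentation (hA : Module.finrank ℝ (A ⧸ maximalIdeal A) = 1) :
    Nonempty (A →ₐ[ℝ] ℝ) := by
  have hb : Function.Bijective (algebraMap ℝ (A ⧸ maximalIdeal A)) := by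
    refine ⟨(algebraMap ℝ _).injective, fun w => ?_⟩
    obtain ⟨c, hc⟩ := (finrank_eq_one_iff_of_nonzero' (1 : A ⧸ maximalIdeal A) one_ne_zero).1 hA w
    exact ⟨c, by rw [Algebra.algebraMap_eq_smul_one, hc]⟩
  exact ⟨((AlgEquiv.ofBijective (Algebra.ofId ℝ (A ⧸ maximalIdeal A)) hb).symm :
    (A ⧸ maximalIdeal A) →ₐ[ℝ] ℝ).comp (Ideal.Quotient.mkₐ ℝ (maximalIdeal A))⟩

omit [Module.Finite ℝ A] in
theorem augmentation_eq_zero_iff (ε : A →ₐ[ℝ] ℝ) {a : A} : ε a = 0 ↔ a ∈ maximalIdeal A := by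
  have hmax : (RingHom.ker ε).IsMaximal :=
    RingHom.ker_isMaximal_of_surjective ε fun r => ⟨algebraMap ℝ A r, ε.commutes r⟩
  rw [← IsLocalRing.eq_maximalIdeal hmax, RingHom.mem_ker]

omit [Module.Finite ℝ A] in
theorem sub_augmentation_mem (ε : A →ₐ[ℝ] ℝ) (a : A) :
    a - algebraMap ℝ A (ε a) ∈ maximalIdeal A := by
  rw [← augmentation_eq_zero_iff ε, map_sub, AlgHom.commutes]
  exact sub_self _

end WeilAlgebra

/-! ### Near points and derivations along them. -/

variable {n : ℕ} {M : Type*} [TopologicalSpace M] [ChartedSpace (EuclideanSpace ℝ (Fin n)) M]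
  {A : Type*} [CommRing A] [Algebra ℝ A] [IsLocalRing A]

/-- The morphism `ξ : C^∞(M) → A` is near to the point `x`. -/
def IsNear (ξ : Smooth n M →ₐ[ℝ] A) (x : M) : Prop :=
  ∀ f : Smooth n M, ξ f - algebraMap ℝ A (f x) ∈ maximalIdeal A

/-- `D` is a derivation along the morphism `ξ`. -/
def IsDerivAlong (ξ : Smooth n M →ₐ[ℝ] A) (D : Smooth n M →ₗ[ℝ] A) : Prop :=
  ∀ f g : Smooth n M, D (f * g) = ξ f * D g + ξ g * D f

omit [IsLocalRing A] in
theorem IsDerivAlong.map_one {ξ : Smooth n M →ₐ[ℝ] A} {D : Smooth n M →ₗ[ℝ] A}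
    (hD : IsDerivAlong ξ D) : D 1 = 0 := by
  simpa using hD 1 1

omit [IsLocalRing A] in
theorem IsDerivAlong.map_const {ξ : Smooth n M →ₐ[ℝ] A} {D : Smooth n M →ₗ[ℝ] A}
    (hD : IsDerivAlong ξ D) (c : ℝ) : D (algebraMap ℝ _ c) = 0 := by
  rw [Algebra.algebraMap_eq_smul_one, map_smul, hD.map_one, smul_zero]

omit [IsLocalRing A] in
theorem IsDerivAlong.sub {ξ : Smooth n M →ₐ[ℝ] A} {D D' : Smooth n M →ₗ[ℝ] A}
    (hD : IsDerivAlong ξ D) (hD' : IsDerivAlong ξ D') : IsDerivAlong ξ (D - D') := fun f g => by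
  simp only [LinearMap.sub_apply, hD f g, hD' f g]
  ring

theorem IsNear.isUnit {ξ : Smooth n M →ₐ[ℝ] A} {x : M} (hξ : IsNear ξ x) {f : Smooth n M}
    (hf : f x ≠ 0) : IsUnit (ξ f) := by
  by_contra h
  have h1 : ξ f ∈ maximalIdeal A := (mem_maximalIdeal _).2 h
  have h2 := Ideal.sub_mem _ h1 (hξ f)
  rw [sub_sub_cancel] at h2
  exact (mem_maximalIdeal _).1 h2 (((IsUnit.mk0 _ hf)).map (algebraMap ℝ A))

variable [IsManifold (𝓡 n) ∞ M] [T2Space M]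

/-- A bump σ at x supported where f = 0 satisfies σf = 0, while ξ(σ) is a unit because σ(x) ≠ 0. -/
theorem IsNear.eq_zero {ξ : Smooth n M →ₐ[ℝ] A} {x : M} (hξ : IsNear ξ x) {f : Smooth n M}
    (hf : ∀ᶠ z in 𝓝 x, f z = 0) : ξ f = 0 := by
  obtain ⟨σ, hσ, hσ'⟩ := exists_bump (n := n) hf
  have h0 : σ * f = 0 := by
    ext z
    change σ z * f z = 0
    by_cases hz : f z = 0
    · rw [hz, mul_zero]
    · rw [(hσ' z hz).self_of_nhds, zero_mul]
  have h1 : ξ σ * ξ f = 0 := by rw [← map_mul, h0, map_zero]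
  exact (hξ.isUnit (by rw [hσ.self_of_nhds]; exact one_ne_zero)).mul_right_eq_zero.1 h1

theorem IsNear.congr {ξ : Smooth n M →ₐ[ℝ] A} {x : M} (hξ : IsNear ξ x) {f g : Smooth n M}
    (h : ∀ᶠ z in 𝓝 x, f z = g z) : ξ f = ξ g := by
  rw [← sub_eq_zero, ← map_sub]
  refine hξ.eq_zero (h.mono fun z hz => ?_)
  change f z - g z = 0
  rw [hz, sub_self]

theorem IsNear.deriv_eq_zero {ξ : Smooth n M →ₐ[ℝ] A} {x : M} (hξ : IsNear ξ x)
    {D : Smooth n M →ₗ[ℝ] A} (hD : IsDerivAlong ξ D) {f : Smooth n M}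
    (hf : ∀ᶠ z in 𝓝 x, f z = 0) : D f = 0 := by
  obtain ⟨σ, hσ, hσ'⟩ := exists_bump (n := n) hf
  have h0 : σ * f = 0 := by
    ext z
    change σ z * f z = 0
    by_cases hz : f z = 0
    · rw [hz, mul_zero]
    · rw [(hσ' z hz).self_of_nhds, zero_mul]
  have h1 := hD σ f
  rw [h0, map_zero, hξ.eq_zero hf, zero_mul, add_zero] at h1
  exact (hξ.isUnit (by rw [hσ.self_of_nhds]; exact one_ne_zero)).mul_right_eq_zero.1 h1.symm

theorem IsNear.deriv_congr {ξ : Smooth n M →ₐ[ℝ] A} {x : M} (hξ : IsNear ξ x)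
    {D : Smooth n M →ₗ[ℝ] A} (hD : IsDerivAlong ξ D) {f g : Smooth n M}
    (h : ∀ᶠ z in 𝓝 x, f z = g z) : D f = D g := by
  rw [← sub_eq_zero, ← map_sub]
  refine hξ.deriv_eq_zero hD (h.mono fun z hz => ?_)
  change f z - g z = 0
  rw [hz, sub_self]

omit [IsManifold (𝓡 n) ∞ M] [T2Space M] in
theorem LocalFrame.slope' {x₀ : M} (F : LocalFrame n x₀) {y : M} (hy : y ∈ F.U)
    (f : Smooth n M) : ∃ g : Fin n → Smooth n M, ∀ᶠ z in 𝓝 y,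
      f z = (algebraMap ℝ (Smooth n M) (f y)
        + ∑ i, (F.coord i - algebraMap ℝ _ (F.coord i y)) * g i) z := by
  obtain ⟨g, hg⟩ := F.slope y hy f
  refine ⟨g, hg.mono fun z hz => ?_⟩
  rw [hz]
  change _ = f y + ContMDiffMap.coeFnRingHom (∑ i, _) z
  rw [map_sum, Finset.sum_apply]
  rfl

variable [Module.Finite ℝ A]

/-- A derivation along a near point is determined by its values on local coordinates. -/
theorem LocalFrame.deriv_eq_zero {x₀ : M} (F : LocalFrame n x₀) {y : M} (hy : y ∈ F.U)
    {ξ : Smooth n M →ₐ[ℝ] A} (hξ : IsNear ξ y) {D : Smooth n M →ₗ[ℝ] A}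
    (hD : IsDerivAlong ξ D) (h : ∀ i, D (F.coord i) = 0) : D = 0 := by
  have := isNoetherianRing_of_finite A
  ext f
  -- By Hadamard and the Leibniz rule, D f = Σ (ξ(x_i) − x_i(y)) D g_i once D kills the x_i; the
  -- first factors lie in 𝔪.
  refine eq_zero_of_mem_maximalIdeal_smul_span D (fun f => ?_) f
  obtain ⟨g, hg⟩ := F.slope' hy f
  rw [hξ.deriv_congr hD hg, map_add, hD.map_const, zero_add, map_sum]
  refine Submodule.sum_mem _ fun i _ => ?_
  rw [hD, map_sub D, h, hD.map_const, sub_zero, mul_zero, add_zero, ← smul_eq_mul]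
  refine Submodule.smul_mem_smul ?_ (Submodule.subset_span ⟨g i, rfl⟩)
  rw [map_sub, AlgHom.commutes]
  exact hξ _

theorem LocalFrame.deriv_ext {x₀ : M} (F : LocalFrame n x₀) {y : M} (hy : y ∈ F.U)
    {ξ : Smooth n M →ₐ[ℝ] A} (hξ : IsNear ξ y) {D D' : Smooth n M →ₗ[ℝ] A}
    (hD : IsDerivAlong ξ D) (hD' : IsDerivAlong ξ D')
    (h : ∀ i, D (F.coord i) = D' (F.coord i)) : D = D' :=
  sub_eq_zero.1 (F.deriv_eq_zero hy hξ (hD.sub hD') fun i => sub_eq_zero.2 (h i))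

/-- A near point is determined by its values on local coordinates. -/
theorem LocalFrame.algHom_ext {x₀ : M} (F : LocalFrame n x₀) {y : M} (hy : y ∈ F.U)
    {ξ ζ : Smooth n M →ₐ[ℝ] A} (hξ : IsNear ξ y) (hζ : IsNear ζ y)
    (h : ∀ i, ξ (F.coord i) = ζ (F.coord i)) : ξ = ζ := by
  have := isNoetherianRing_of_finite A
  ext f
  rw [← sub_eq_zero]
  -- Here Hadamard gives ξ f − ζ f = Σ (ζ(x_i) − x_i(y)) (ξ g_i − ζ g_i), again in 𝔪 times the span
  -- of the differences.
  refine eq_zero_of_mem_maximalIdeal_smul_span (fun f => ξ f - ζ f) (fun f => ?_) f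
  obtain ⟨g, hg⟩ := F.slope' hy f
  simp only [hξ.congr hg, hζ.congr hg, map_add, map_sum, map_mul, map_sub, AlgHom.commutes, h,
    add_sub_add_left_eq_sub, ← Finset.sum_sub_distrib, ← mul_sub]
  refine Submodule.sum_mem _ fun i _ => ?_
  rw [← smul_eq_mul]
  exact Submodule.smul_mem_smul (hζ _) (Submodule.subset_span ⟨g i, rfl⟩)

end NearAlgebra

/-! ### Differentiable curves in a Weil algebra -/

section CurveAlgebra

open Filter Topology

variable {A : Type*} [CommRing A] [Algebra ℝ A]

/-- The curve `φ` in the finite-dimensional algebra `A` has derivative `a` at `0`. -/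
def HasDerivA (φ : ℝ → A) (a : A) : Prop :=
  ∀ l : A →ₗ[ℝ] ℝ, HasDerivAt (fun t => l (φ t)) (l a) 0

theorem HasDerivA.congr {φ ψ : ℝ → A} {a : A} (hφ : HasDerivA φ a)
    (h : ∀ᶠ t in 𝓝 0, ψ t = φ t) : HasDerivA ψ a := fun l =>
  (hφ l).congr_of_eventuallyEq (h.mono fun _ ht => congrArg l ht)

theorem hasDerivA_const (a : A) : HasDerivA (fun _ => a) 0 := fun l => by
  simpa using hasDerivAt_const (0 : ℝ) (l a)

theorem HasDerivA.add {φ ψ : ℝ → A} {a b : A} (hφ : HasDerivA φ a) (hψ : HasDerivA ψ b) :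
    HasDerivA (fun t => φ t + ψ t) (a + b) := fun l => by
  simpa using (hφ l).fun_add (hψ l)

theorem HasDerivA.map {B : Type*} [CommRing B] [Algebra ℝ B] {φ : ℝ → A} {a : A}
    (hφ : HasDerivA φ a) (L : A →ₗ[ℝ] B) : HasDerivA (fun t => L (φ t)) (L a) := fun l =>
  hφ (l ∘ₗ L)

theorem HasDerivA.sum {ι : Type*} (s : Finset ι) {φ : ι → ℝ → A} {a : ι → A}
    (h : ∀ i, HasDerivA (φ i) (a i)) : HasDerivA (fun t => ∑ i ∈ s, φ i t) (∑ i ∈ s, a i) :=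
  fun l => by simpa using HasDerivAt.fun_sum (u := s) fun i _ => h i l

theorem hasDerivA_smul {h : ℝ → ℝ} {r : ℝ} (hh : HasDerivAt h r 0) (a : A) :
    HasDerivA (fun t => h t • a) (r • a) := fun l => by
  simpa using hh.mul_const (l a)

variable [Module.Finite ℝ A]

theorem ext_linearForm {a b : A} (h : ∀ l : A →ₗ[ℝ] ℝ, l a = l b) : a = b :=
  (Module.finBasis ℝ A).ext_elem fun i => h ((Module.finBasis ℝ A).coord i)

theorem HasDerivA.unique {φ : ℝ → A} {a b : A} (ha : HasDerivA φ a) (hb : HasDerivA φ b) :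
    a = b :=
  ext_linearForm fun l => (ha l).unique (hb l)

theorem hasDerivA_of_coord {φ : ℝ → A} {a : A} (h : ∀ i, HasDerivAt
    (fun t => (Module.finBasis ℝ A).coord i (φ t)) ((Module.finBasis ℝ A).coord i a) 0) :
    HasDerivA φ a := fun l => by
  have key : ∀ x : A, l x = ∑ i, (Module.finBasis ℝ A).coord i x * l (Module.finBasis ℝ A i) := by
    intro x
    conv_lhs => rw [← (Module.finBasis ℝ A).sum_repr x]
    simp only [map_sum, map_smul, smul_eq_mul, Module.Basis.coord_apply]
  rw [funext fun t => key (φ t), key a]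
  exact HasDerivAt.fun_sum fun i _ => (h i).mul_const _

theorem linearForm_mul (l : A →ₗ[ℝ] ℝ) (x y : A) :
    l (x * y) = ∑ i, ∑ j, (Module.finBasis ℝ A).coord i x * (Module.finBasis ℝ A).coord j y *
      l (Module.finBasis ℝ A i * Module.finBasis ℝ A j) := by
  conv_lhs => rw [← (Module.finBasis ℝ A).sum_repr x, ← (Module.finBasis ℝ A).sum_repr y,
    Finset.sum_mul_sum, map_sum]
  refine Finset.sum_congr rfl fun i _ => ?_
  rw [map_sum]
  refine Finset.sum_congr rfl fun j _ => ?_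
  rw [smul_mul_smul_comm, map_smul, smul_eq_mul, Module.Basis.coord_apply,
    Module.Basis.coord_apply]

/-- Multiplication of A is bilinear, so in a basis this is the ordinary product rule for finitely
many real products. -/
theorem HasDerivA.mul {φ ψ : ℝ → A} {a b : A} (hφ : HasDerivA φ a) (hψ : HasDerivA ψ b) :
    HasDerivA (fun t => φ t * ψ t) (φ 0 * b + ψ 0 * a) := fun l => by
  simp only [linearForm_mul l (φ _), map_add, mul_comm (ψ 0) a, linearForm_mul l a,
    ← Finset.sum_add_distrib]
  refine HasDerivAt.fun_sum fun i _ => HasDerivAt.fun_sum fun j _ => ?_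
  refine (((hφ ((Module.finBasis ℝ A).coord i)).fun_mul
    (hψ ((Module.finBasis ℝ A).coord j))).mul_const _).congr_deriv ?_
  ring

theorem HasDerivA.exists_pow {φ : ℝ → A} {a : A} (hφ : HasDerivA φ a) (k : ℕ) :
    ∃ b, HasDerivA (fun t => φ t ^ k) b := by
  induction k with
  | zero => exact ⟨0, by simpa using hasDerivA_const (1 : A)⟩
  | succ k ih =>
    obtain ⟨b, hb⟩ := ih
    exact ⟨_, by simpa [pow_succ] using hb.mul hφ⟩

end CurveAlgebra

/-! ### Translation of near points along vector fields -/

section Shift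

open Filter Topology IsLocalRing

variable {n : ℕ} {M : Type*} [TopologicalSpace M] [ChartedSpace (EuclideanSpace ℝ (Fin n)) M]
  {A : Type*} [CommRing A] [Algebra ℝ A]

open Finset in
theorem VField.iterate_mul (X : VField n M) (k : ℕ) (f g : Smooth n M) :
    X^[k] (f * g) = ∑ p ∈ antidiagonal k, k.choose p.1 • (X^[p.1] f * X^[p.2] g) := by
  induction k with
  | zero => simp
  | succ k ih =>
    rw [sum_antidiagonal_choose_succ_nsmul (M := Smooth n M) (fun i j => X^[i] f * X^[j] g) k]
    simp only [Function.iterate_succ_apply', ih, map_sum, map_nsmul, Derivation.leibniz,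
      smul_add, sum_add_distrib, add_right_inj, smul_eq_mul]
    refine sum_congr rfl fun ⟨i, j⟩ hij => ?_
    rw [k.choose_symm_of_eq_add (mem_antidiagonal.1 hij).symm, mul_comm]

theorem VField.iterate_add (X : VField n M) (k : ℕ) (f g : Smooth n M) :
    X^[k] (f + g) = X^[k] f + X^[k] g := by
  induction k with
  | zero => rfl
  | succ k ih => simp only [Function.iterate_succ_apply', ih, map_add]

theorem VField.iterate_const (X : VField n M) (k : ℕ) (c : ℝ) :
    X^[k + 1] (algebraMap ℝ (Smooth n M) c) = 0 := by
  induction k with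
  | zero => simp
  | succ k ih => rw [Function.iterate_succ_apply', ih, map_zero]

/-- The `k`-th term of the series `exp(m X)` evaluated at `ξ` and `f`. -/
def shiftTerm (ξ : Smooth n M →ₐ[ℝ] A) (X : VField n M) (m : A) (k : ℕ) (f : Smooth n M) : A :=
  ((k.factorial : ℝ)⁻¹) • (m ^ k * ξ (X^[k] f))

open Finset in
-- The iterated Leibniz rule, with the binomial coefficients absorbed by the factorials; this makes
-- exp(mX) multiplicative.
theorem shiftTerm_mul (ξ : Smooth n M →ₐ[ℝ] A) (X : VField n M) (m : A) (k : ℕ)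
    (f g : Smooth n M) : shiftTerm ξ X m k (f * g) =
      ∑ p ∈ antidiagonal k, shiftTerm ξ X m p.1 f * shiftTerm ξ X m p.2 g := by
  simp only [shiftTerm, VField.iterate_mul, map_sum, mul_sum, smul_sum]
  refine sum_congr rfl fun ⟨i, j⟩ hij => ?_
  rw [HasAntidiagonal.mem_antidiagonal] at hij
  subst hij
  simp only [map_nsmul, map_mul, smul_mul_smul_comm, pow_add]
  rw [← Nat.cast_smul_eq_nsmul ℝ, mul_smul_comm, smul_smul]
  congr 1
  · have hi : (i.factorial : ℝ) ≠ 0 := by positivity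
    have hj : (j.factorial : ℝ) ≠ 0 := by positivity
    have hij : ((i + j).factorial : ℝ) ≠ 0 := by positivity
    have h := Nat.add_choose_mul_factorial_mul_factorial i j
    rw [← Nat.choose_symm_add] at h
    have h' : ((i + j).choose i : ℝ) * i.factorial * j.factorial = (i + j).factorial := by
      exact_mod_cast h
    field_simp
    linarith
  · ring

open Finset in
/-- The translate `exp(m X) ξ` of the morphism `ξ` along the vector field `X`, for a nilpotent
element `m`. -/
def shift (ξ : Smooth n M →ₐ[ℝ] A) (X : VField n M) (m : A) (N : ℕ) (hm : m ^ (N + 2) = 0) :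
    Smooth n M →ₐ[ℝ] A :=
  AlgHom.ofLinearMap
    { toFun := fun f => ∑ k ∈ range (N + 2), shiftTerm ξ X m k f
      map_add' := fun f g => by
        simp only [shiftTerm, VField.iterate_add, map_add, mul_add, smul_add, sum_add_distrib]
      map_smul' := fun c f => by
        have h : ∀ k, X^[k] (c • f) = c • X^[k] f := fun k => by
          induction k with
          | zero => rfl
          | succ k ih =>
            rw [Function.iterate_succ_apply', Function.iterate_succ_apply', ih]
            exact X.toLinearMap.map_smul c _
        simp only [shiftTerm, h, map_smul, mul_smul_comm, smul_sum, RingHom.id_apply]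
        exact sum_congr rfl fun k _ => smul_comm _ _ _ }
    (by
      change ∑ k ∈ range (N + 2), shiftTerm ξ X m k 1 = 1
      rw [sum_range_succ', sum_eq_zero, zero_add]
      · simp [shiftTerm]
      · intro k _
        have := X.iterate_const k 1
        rw [map_one] at this
        simp [shiftTerm, this])
    (fun f g => by
      change ∑ k ∈ range (N + 2), shiftTerm ξ X m k (f * g) =
        (∑ k ∈ range (N + 2), shiftTerm ξ X m k f) * ∑ k ∈ range (N + 2), shiftTerm ξ X m k g
      -- The product terms with i + j ≥ N + 2 vanish by nilpotency of m; the others are grouped by k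
      -- = i + j.
      rw [sum_mul_sum, ← sum_product', ← sum_filter_add_sum_filter_not _
        (fun p : ℕ × ℕ => p.1 + p.2 < N + 2), sum_eq_zero (s := filter (fun p => ¬ _) _), add_zero,
        ← sum_fiberwise_of_maps_to (g := fun p : ℕ × ℕ => p.1 + p.2) (t := range (N + 2))]
      · refine sum_congr rfl fun k hk => ?_
        rw [shiftTerm_mul]
        refine sum_congr ?_ fun _ _ => rfl
        ext ⟨i, j⟩
        simp only [HasAntidiagonal.mem_antidiagonal, mem_filter, mem_product, mem_range] at hk ⊢
        omega
      · intro p hp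
        simpa using (mem_filter.1 hp).2
      · rintro ⟨i, j⟩ hp
        have hij : N + 2 ≤ i + j := by simpa using (mem_filter.1 hp).2
        have h0 : m ^ i * m ^ j = 0 := by
          rw [← pow_add, ← Nat.add_sub_cancel' hij, pow_add, hm, zero_mul]
        simp only [shiftTerm, smul_mul_smul_comm]
        rw [mul_mul_mul_comm, h0, zero_mul, smul_zero])

theorem shift_apply (ξ : Smooth n M →ₐ[ℝ] A) (X : VField n M) (m : A) (N : ℕ)
    (hm : m ^ (N + 2) = 0) (f : Smooth n M) :
    shift ξ X m N hm f = ∑ k ∈ Finset.range (N + 2), shiftTerm ξ X m k f := rfl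

/-- Every term of the exponential of order at least 1 carries a factor m ∈ 𝔪, so the base point does
not move. -/
theorem IsNear.shift [IsLocalRing A] {ξ : Smooth n M →ₐ[ℝ] A} {x : M} (hξ : IsNear ξ x)
    (X : VField n M) {m : A} (hmA : m ∈ maximalIdeal A) (N : ℕ) (hm : m ^ (N + 2) = 0) :
    IsNear (shift ξ X m N hm) x := fun f => by
  rw [shift_apply, Finset.sum_range_succ', add_sub_assoc]
  refine Ideal.add_mem _ (Submodule.sum_mem _ fun k _ => ?_) ?_
  · rw [shiftTerm, Algebra.smul_def, pow_succ']
    exact Ideal.mul_mem_left _ _ (Ideal.mul_mem_right _ _ (Ideal.mul_mem_right _ _ hmA))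
  · simpa [shiftTerm] using hξ f

/-- Evaluation at a point. -/
def evalHom (x : M) : Smooth n M →ₐ[ℝ] ℝ :=
  (Pi.evalAlgHom ℝ (fun _ : M => ℝ) x).comp ContMDiffMap.coeFnAlgHom

theorem evalHom_apply (x : M) (f : Smooth n M) : evalHom x f = f x := rfl

theorem isNear_evalHom (x : M) : IsNear (evalHom (n := n) x) x := fun f => by
  rw [evalHom_apply]
  exact (sub_self (f x)) ▸ Ideal.zero_mem _

variable (A) in
/-- Evaluation at a point, as a morphism into `A`. -/
def evalHomA (x : M) : Smooth n M →ₐ[ℝ] A := (Algebra.ofId ℝ A).comp (evalHom x)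

theorem evalHomA_apply (x : M) (f : Smooth n M) : evalHomA A x f = algebraMap ℝ A (f x) := rfl

theorem isNear_evalHomA [IsLocalRing A] (x : M) : IsNear (evalHomA (n := n) A x) x := fun f => by
  rw [evalHomA_apply, sub_self]
  exact Ideal.zero_mem _

/-- The derivation `f ↦ ξ (X f)` along `ξ`. -/
def VField.pull (X : VField n M) (ξ : Smooth n M →ₐ[ℝ] A) : Smooth n M →ₗ[ℝ] A :=
  ξ.toLinearMap ∘ₗ X.toLinearMap

theorem VField.pull_apply (X : VField n M) (ξ : Smooth n M →ₐ[ℝ] A) (f : Smooth n M) :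
    X.pull ξ f = ξ (X f) := rfl

theorem VField.isDerivAlong_pull (X : VField n M) (ξ : Smooth n M →ₐ[ℝ] A) :
    IsDerivAlong ξ (X.pull ξ) := fun f g => by
  simp only [VField.pull_apply, Derivation.leibniz, smul_eq_mul, map_add, map_mul]

variable [IsManifold (𝓡 n) ∞ M] [T2Space M]

theorem VField.congr (X : VField n M) {x : M} {f g : Smooth n M}
    (h : ∀ᶠ z in 𝓝 x, f z = g z) : X f x = X g x :=
  (isNear_evalHom x).deriv_congr (X.isDerivAlong_pull _) h

theorem VField.eq_zero_of_const (X : VField n M) {x : M} {f : Smooth n M} (c : ℝ)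
    (h : ∀ᶠ z in 𝓝 x, f z = c) : X f x = 0 := by
  rw [X.congr (g := algebraMap ℝ _ c) h]
  exact congrArg (fun g : Smooth n M => g x) (X.map_algebraMap c)

theorem LocalFrame.iterate_coord {x₀ : M} (F : LocalFrame n x₀) (i j : Fin n) (k : ℕ) {y : M}
    (hy : y ∈ F.U) : (F.field j)^[k + 2] (F.coord i) y = 0 := by
  induction k generalizing y with
  | zero =>
    refine (F.field j).eq_zero_of_const (if j = i then 1 else 0) ?_
    filter_upwards [F.isOpen_U.mem_nhds hy] with z hz
    exact F.field_coord z hz j i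
  | succ k ih =>
    rw [Function.iterate_succ_apply']
    refine (F.field j).eq_zero_of_const 0 ?_
    filter_upwards [F.isOpen_U.mem_nhds hy] with z hz
    exact ih hz

variable [IsLocalRing A]

theorem LocalFrame.map_field_coord {x₀ : M} (F : LocalFrame n x₀) {y : M} (hy : y ∈ F.U)
    {ξ : Smooth n M →ₐ[ℝ] A} (hξ : IsNear ξ y) (i j : Fin n) :
    ξ (F.field i (F.coord j)) = if i = j then 1 else 0 := by
  rw [hξ.congr (g := algebraMap ℝ _ (if i = j then 1 else 0)), AlgHom.commutes]
  · split_ifs <;> simp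
  · filter_upwards [F.isOpen_U.mem_nhds hy] with z hz
    exact F.field_coord z hz i j

/-- Since ∂_j x_i is constant on U, the exponential series of x_i stops after its linear term. -/
theorem LocalFrame.shift_coord {x₀ : M} (F : LocalFrame n x₀) {y : M} (hy : y ∈ F.U)
    {ξ : Smooth n M →ₐ[ℝ] A} (hξ : IsNear ξ y) (j : Fin n) {m : A} (N : ℕ)
    (hm : m ^ (N + 2) = 0) (i : Fin n) :
    shift ξ (F.field j) m N hm (F.coord i) = ξ (F.coord i) + if j = i then m else 0 := by
  rw [shift_apply, Finset.sum_range_succ', Finset.sum_range_succ', Finset.sum_eq_zero, zero_add]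
  · have := F.map_field_coord hy hξ j i
    simp [shiftTerm, this, add_comm]
  · intro k _
    have : ξ ((F.field j)^[k + 2] (F.coord i)) = 0 := hξ.eq_zero (by
      filter_upwards [F.isOpen_U.mem_nhds hy] with z hz
      exact F.iterate_coord i j k hz)
    rw [shiftTerm, this, mul_zero, smul_zero]

variable [Module.Finite ℝ A]

/-- Starting from evaluation at c(t), each translation exp((m_j + tν_j) ∂_j) corrects the j-th
coordinate and leaves the others alone. Only the existence of derivatives is recorded for general f;
their values follow later from those on coordinates. -/
theorem LocalFrame.exists_curve_finset {x₀ : M} (F : LocalFrame n x₀) (c : ℝ → M)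
    (hc : ∀ f : Smooth n M, DifferentiableAt ℝ (fun t => f (c t)) 0) (m ν : Fin n → A)
    (hm : ∀ i, m i ∈ maximalIdeal A) (hν : ∀ i, ν i ∈ maximalIdeal A) (s : Finset (Fin n)) :
    ∃ γ : ℝ → Smooth n M →ₐ[ℝ] A, (∀ t, IsNear (γ t) (c t)) ∧
      (∀ f, ∃ d, HasDerivA (fun t => γ t f) d) ∧
      ∀ t, c t ∈ F.U → ∀ i, γ t (F.coord i) =
        algebraMap ℝ A (F.coord i (c t)) + if i ∈ s then m i + t • ν i else 0 := by
  classical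
  obtain ⟨N, hN⟩ := exists_pow_eq_zero A
  have hmν : ∀ i (t : ℝ), m i + t • ν i ∈ maximalIdeal A := fun i t =>
    Ideal.add_mem _ (hm i) (by rw [Algebra.smul_def]; exact Ideal.mul_mem_left _ _ (hν i))
  induction s using Finset.induction_on with
  | empty =>
    refine ⟨fun t => evalHomA A (c t), fun t => isNear_evalHomA _, fun f => ?_, fun t _ i => ?_⟩
    · refine ⟨_, (hasDerivA_smul (hc f).hasDerivAt (1 : A)).congr (Eventually.of_forall fun t => ?_)⟩
      rw [evalHomA_apply, Algebra.algebraMap_eq_smul_one]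
    · simp [evalHomA_apply]
  | insert j s hj ih =>
    obtain ⟨γ, hγ, hd, hx⟩ := ih
    refine ⟨fun t => shift (γ t) (F.field j) (m j + t • ν j) N (hN _ (hmν j t)),
      fun t => (hγ t).shift _ (hmν j t) _ _, fun f => ?_, fun t ht i => ?_⟩
    · have h1 : HasDerivA (fun t : ℝ => m j + t • ν j) (0 + (1 : ℝ) • ν j) :=
        (hasDerivA_const _).add (hasDerivA_smul (hasDerivAt_id (0 : ℝ)) (ν j))
      choose p hp using h1.exists_pow
      choose d hd using hd
      exact ⟨_, HasDerivA.sum (Finset.range (N + 2)) fun k =>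
        ((hp k).mul (hd ((F.field j)^[k] f))).map (LinearMap.lsmul ℝ A ((k.factorial : ℝ)⁻¹))⟩
    · rw [F.shift_coord ht (hγ t), hx t ht, add_assoc]
      congr 1
      by_cases hji : j = i
      · subst hji
        simp [hj]
      · simp [hji, Ne.symm hji, Finset.mem_insert]

/-- Every derivation along a near point is the velocity of a curve of near points. -/
theorem NearPoint.exists_curve (ε : A →ₐ[ℝ] ℝ) (ξ : NearPoint n M A) {D : Smooth n M →ₗ[ℝ] A}
    (hD : IsDerivAlong ξ.toAlgHom D) : ∃ γ : ℝ → NearPoint n M A, γ 0 = ξ ∧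
      ∀ f, HasDerivA (fun t => (γ t).toAlgHom f) (D f) := by
  obtain ⟨x, hξ⟩ := ξ.exists_base
  replace hξ : IsNear ξ.toAlgHom x := hξ
  obtain ⟨F⟩ := nonempty_localFrame (n := n) x
  -- The base curve takes the real parts ε(D x_i) as velocity; the nilpotent remainders D x_i − ε(D
  -- x_i) go into ν.
  obtain ⟨c, hc0, hcc, hcd, hcx⟩ := F.curve x F.mem_U fun i => ε (D (F.coord i))
  obtain ⟨γ, hγ, hd, hx⟩ := F.exists_curve_finset c hcd
    (fun i => ξ.toAlgHom (F.coord i) - algebraMap ℝ A (F.coord i x))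
    (fun i => D (F.coord i) - algebraMap ℝ A (ε (D (F.coord i)))) (fun i => hξ _)
    (fun i => sub_augmentation_mem ε _) Finset.univ
  have h0 : γ 0 = ξ.toAlgHom := by
    refine F.algHom_ext F.mem_U (hc0 ▸ hγ 0) hξ fun i => ?_
    rw [hx 0 (hc0.symm ▸ F.mem_U)]
    simp [hc0]
  choose d hd using hd
  -- The velocity of γ is itself a derivation along ξ, so comparison with D on coordinates suffices.
  let D' : Smooth n M →ₗ[ℝ] A :=
    { toFun := d
      map_add' := fun f g => (hd (f + g)).unique
        (((hd f).add (hd g)).congr (Eventually.of_forall fun t => map_add _ _ _))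
      map_smul' := fun r f => (hd (r • f)).unique
        (((hd f).map (LinearMap.lsmul ℝ A r)).congr (Eventually.of_forall fun t => map_smul _ _ _)) }
  have hD' : IsDerivAlong ξ.toAlgHom D' := fun f g => by
    rw [← h0]
    exact (hd (f * g)).unique
      (((hd f).mul (hd g)).congr (Eventually.of_forall fun t => map_mul _ _ _))
  have hDD' : D' = D := by
    refine F.deriv_ext F.mem_U hξ hD' hD fun i => (hd _).unique ?_
    have h1 := (hasDerivA_smul (hcx i) (1 : A)).add
      ((hasDerivA_const (ξ.toAlgHom (F.coord i) - algebraMap ℝ A (F.coord i x))).add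
        (hasDerivA_smul (hasDerivAt_id (0 : ℝ))
          (D (F.coord i) - algebraMap ℝ A (ε (D (F.coord i))))))
    rw [one_smul, zero_add, ← Algebra.algebraMap_eq_smul_one, add_sub_cancel] at h1
    refine h1.congr ?_
    have hU : ∀ᶠ t in 𝓝 (0 : ℝ), c t ∈ F.U :=
      hcc.eventually (F.isOpen_U.mem_nhds (hc0.symm ▸ F.mem_U))
    filter_upwards [hU] with t ht
    rw [hx t ht]
    simp [Algebra.algebraMap_eq_smul_one]
  refine ⟨fun t => ⟨γ t, c t, hγ t⟩, NearPoint.ext h0, fun f => ?_⟩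
  rw [← hDD']
  exact hd f

end Shift

/-! ### Smooth functions on the Weil bundle -/

section BundleFunctions

open Filter Topology IsLocalRing

variable {n : ℕ} {M : Type*} [TopologicalSpace M] [ChartedSpace (EuclideanSpace ℝ (Fin n)) M]
  {A : Type*} [CommRing A] [Algebra ℝ A] [IsLocalRing A]

theorem nhds_nearPoint (ξ : NearPoint n M A) :
    𝓝 ξ = ⨅ (f : Smooth n M) (l : A →ₗ[ℝ] ℝ), comap (coordFun f l) (𝓝 (coordFun f l ξ)) := by
  simp only [nhds_iInf, nhds_induced]

theorem continuous_coordFun (f : Smooth n M) (l : A →ₗ[ℝ] ℝ) :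
    Continuous (coordFun f l : NearPoint n M A → ℝ) :=
  continuous_iInf_dom (i := f) (continuous_iInf_dom (i := l) continuous_induced_dom)

theorem isSmoothReal_comp {k : ℕ} {g : (Fin k → ℝ) → ℝ} (hg : ContDiff ℝ ∞ g)
    (f : Fin k → Smooth n M) (l : Fin k → A →ₗ[ℝ] ℝ) :
    IsSmoothReal fun ζ : NearPoint n M A => g fun i => coordFun (f i) (l i) ζ := fun _ =>
  ⟨Set.univ, isOpen_univ, trivial, k, f, l, g, hg, fun _ _ => rfl⟩

theorem isSmoothReal_of_locally {φ : NearPoint n M A → ℝ}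
    (h : ∀ ξ, ∃ U : Set (NearPoint n M A), IsOpen U ∧ ξ ∈ U ∧ ∃ ψ : NearPoint n M A → ℝ,
      IsSmoothReal ψ ∧ ∀ ζ ∈ U, φ ζ = ψ ζ) : IsSmoothReal φ := by
  intro ξ
  obtain ⟨U, hU, hξU, ψ, hψ, hφψ⟩ := h ξ
  obtain ⟨V, hV, hξV, k, f, l, g, hg, hψg⟩ := hψ ξ
  exact ⟨U ∩ V, hU.inter hV, ⟨hξU, hξV⟩, k, f, l, g, hg, fun ζ hζ =>
    (hφψ ζ hζ.1).trans (hψg ζ hζ.2)⟩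

theorem exists_bump_real {c : ℝ} {W : Set ℝ} (hW : W ∈ 𝓝 c) :
    ∃ G : ℝ → ℝ, ContDiff ℝ ∞ G ∧ G c = 1 ∧ ∀ v ∉ W, G v = 0 := by
  obtain ⟨r, hr, h⟩ := Metric.mem_nhds_iff.1 hW
  let b : ContDiffBump c := ⟨r / 2, r, by positivity, by linarith⟩
  exact ⟨b, b.contDiff, b.eventuallyEq_one.eq_of_nhds, fun v hv =>
    b.zero_of_le_dist (not_lt.1 fun hlt => hv (h hlt))⟩

/-- The sets U with this property form a filter, so it is enough to treat preimages of intervals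
under the functions `coordFun`, which generate the topology. -/
theorem exists_smoothReal_bump {ξ : NearPoint n M A} {U : Set (NearPoint n M A)} (hU : U ∈ 𝓝 ξ) :
    ∃ χ : NearPoint n M A → ℝ, IsSmoothReal χ ∧ χ ξ = 1 ∧ ∀ ζ ∉ U, χ ζ = 0 := by
  let 𝓕 : Filter (NearPoint n M A) :=
    { sets := {U | ∃ χ : NearPoint n M A → ℝ, IsSmoothReal χ ∧ χ ξ = 1 ∧ ∀ ζ ∉ U, χ ζ = 0}
      univ_sets := ⟨fun _ => 1, isSmoothReal_const 1, rfl, fun ζ hζ => absurd trivial hζ⟩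
      sets_of_superset := by
        rintro U V ⟨χ, hχ, h1, h0⟩ hUV
        exact ⟨χ, hχ, h1, fun ζ hζ => h0 ζ fun h => hζ (hUV h)⟩
      inter_sets := by
        rintro U V ⟨χ, hχ, h1, h0⟩ ⟨χ', hχ', h1', h0'⟩
        refine ⟨_, hχ.mul hχ', by rw [h1, h1', one_mul], fun ζ hζ => ?_⟩
        by_cases h : ζ ∈ U
        · rw [h0' ζ fun h' => hζ ⟨h, h'⟩, mul_zero]
        · rw [h0 ζ h, zero_mul] }
  have h𝓕 : 𝓕 ≤ 𝓝 ξ := by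
    rw [nhds_nearPoint]
    refine le_iInf fun f => le_iInf fun l => ?_
    rw [← tendsto_iff_comap]
    intro W hW
    obtain ⟨G, hG, h1, h0⟩ := exists_bump_real hW
    exact ⟨fun ζ => G (coordFun f l ζ), (isSmoothReal_coordFun f l).comp₂
      (isSmoothReal_const 0) (G := fun a _ => G a) (hG.comp contDiff_fst), h1, fun ζ hζ => h0 _ hζ⟩
  exact h𝓕 hU

/-- The chain rule. The right-hand side involves γ only through ξ and D, which later gives smooth
dependence on ξ although the curves are chosen separately at each point. -/
theorem IsSmoothReal.hasDerivAt_comp {φ : NearPoint n M A → ℝ} {ξ : NearPoint n M A}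
    {U : Set (NearPoint n M A)} (hU : IsOpen U) (hξ : ξ ∈ U) {k : ℕ} {f : Fin k → Smooth n M}
    {l : Fin k → A →ₗ[ℝ] ℝ} {g : (Fin k → ℝ) → ℝ} (hg : ContDiff ℝ ∞ g)
    (h : ∀ ζ ∈ U, φ ζ = g fun i => coordFun (f i) (l i) ζ) {γ : ℝ → NearPoint n M A}
    (hγ0 : γ 0 = ξ) {D : Smooth n M → A} (hγ : ∀ f, HasDerivA (fun t => (γ t).toAlgHom f) (D f)) :
    HasDerivAt (fun t => φ (γ t))
      (∑ i, fderiv ℝ g (fun i => coordFun (f i) (l i) ξ) (Pi.single i 1) * l i (D (f i))) 0 := by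
  subst hγ0
  have hγc : Tendsto γ (𝓝 0) (𝓝 (γ 0)) := by
    rw [nhds_nearPoint]
    exact tendsto_iInf.2 fun f => tendsto_iInf.2 fun l => tendsto_comap_iff.2
      (hγ f l).continuousAt
  have h1 : HasDerivAt (fun t => fun i => coordFun (f i) (l i) (γ t))
      (fun i => l i (D (f i))) 0 := hasDerivAt_pi.2 fun i => hγ (f i) (l i)
  have h2 := ((hg.differentiable (by simp)
    (fun i => coordFun (f i) (l i) (γ 0))).hasFDerivAt).comp_hasDerivAt (0 : ℝ) h1
  have h3 : ∑ i, fderiv ℝ g (fun i => coordFun (f i) (l i) (γ 0)) (Pi.single i 1) * l i (D (f i))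
      = fderiv ℝ g (fun i => coordFun (f i) (l i) (γ 0)) (fun i => l i (D (f i))) := by
    conv_rhs => rw [pi_eq_sum_univ' (fun i => l i (D (f i)))]
    rw [map_sum]
    refine Finset.sum_congr rfl fun i _ => ?_
    rw [map_smul, smul_eq_mul, mul_comm]
  rw [h3]
  refine h2.congr_of_eventuallyEq ?_
  filter_upwards [hγc.eventually (hU.mem_nhds hξ)] with t ht
  exact h _ ht

variable [Module.Finite ℝ A]

/-- A smooth real function as an element of `C^∞(M^A, A)`. -/
def ofReal (φ : NearPoint n M A → ℝ) (hφ : IsSmoothReal φ) : SmoothA n M A :=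
  ⟨fun ζ => algebraMap ℝ A (φ ζ), fun l => by
    have : (fun ζ => l (algebraMap ℝ A (φ ζ))) = fun ζ => φ ζ * l 1 := by
      funext ζ
      rw [Algebra.algebraMap_eq_smul_one, map_smul, smul_eq_mul]
    rw [this]
    exact hφ.mul (isSmoothReal_const _)⟩

theorem isRealValued_ofReal (φ : NearPoint n M A → ℝ) (hφ : IsSmoothReal φ) :
    IsRealValued (ofReal φ hφ) := fun ζ => ⟨φ ζ, rfl⟩

theorem SmoothA.ext {φ ψ : SmoothA n M A} (h : ∀ ξ, φ.1 ξ = ψ.1 ξ) : φ = ψ :=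
  Subtype.ext (funext h)

theorem SmoothA.mul_apply (φ ψ : SmoothA n M A) (ξ : NearPoint n M A) :
    (φ * ψ).1 ξ = φ.1 ξ * ψ.1 ξ := rfl

theorem SmoothA.add_apply (φ ψ : SmoothA n M A) (ξ : NearPoint n M A) :
    (φ + ψ).1 ξ = φ.1 ξ + ψ.1 ξ := rfl

theorem SmoothA.sub_apply (φ ψ : SmoothA n M A) (ξ : NearPoint n M A) :
    (φ - ψ).1 ξ = φ.1 ξ - ψ.1 ξ := rfl

theorem SmoothA.zero_apply (ξ : NearPoint n M A) : (0 : SmoothA n M A).1 ξ = 0 := rfl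

theorem SmoothA.smul_apply (a : A) (φ : SmoothA n M A) (ξ : NearPoint n M A) :
    (a • φ).1 ξ = a * φ.1 ξ := rfl

theorem SmoothA.sum_apply {ι : Type*} (s : Finset ι) (φ : ι → SmoothA n M A)
    (ξ : NearPoint n M A) : (∑ i ∈ s, φ i).1 ξ = ∑ i ∈ s, (φ i).1 ξ :=
  map_sum ((Pi.evalRingHom (fun _ : NearPoint n M A => A) ξ).comp
    (smoothAlg n M A).val.toRingHom) φ s

theorem prolong_apply (f : Smooth n M) (ξ : NearPoint n M A) :
    (prolong n M A f).1 ξ = ξ.toAlgHom f := rfl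

theorem ofReal_apply (φ : NearPoint n M A → ℝ) (hφ : IsSmoothReal φ) (ξ : NearPoint n M A) :
    (ofReal φ hφ).1 ξ = algebraMap ℝ A (φ ξ) := rfl

theorem SmoothA.eq_sum_ofReal (φ : SmoothA n M A) :
    φ = ∑ j, Module.finBasis ℝ A j • ofReal (fun ξ => (Module.finBasis ℝ A).coord j (φ.1 ξ))
      (φ.2 ((Module.finBasis ℝ A).coord j)) := by
  refine SmoothA.ext fun ξ => ?_
  rw [SmoothA.sum_apply]
  conv_lhs => rw [← (Module.finBasis ℝ A).sum_repr (φ.1 ξ)]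
  refine Finset.sum_congr rfl fun j _ => ?_
  rw [SmoothA.smul_apply, ofReal_apply, mul_comm, Algebra.smul_def]
  rfl

/-! ### Vector fields on the Weil bundle -/

/-- The value at `ξ` of a derivation `C^∞(M) → C^∞(M^A, A)`. -/
def VFieldAlong.at (D : VFieldAlong n M A) (ξ : NearPoint n M A) : Smooth n M →ₗ[ℝ] A where
  toFun f := (D f).1 ξ
  map_add' f g := by rw [map_add, SmoothA.add_apply]
  map_smul' r f := congrArg (fun ψ : SmoothA n M A => ψ.1 ξ) (D.toLinearMap.map_smul r f)

theorem VFieldAlong.at_apply (D : VFieldAlong n M A) (ξ : NearPoint n M A) (f : Smooth n M) :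
    D.at ξ f = (D f).1 ξ := rfl

theorem VFieldAlong.isDerivAlong_at (D : VFieldAlong n M A) (ξ : NearPoint n M A) :
    IsDerivAlong ξ.toAlgHom (D.at ξ) := fun f g => by
  rw [VFieldAlong.at_apply, Derivation.leibniz]
  rfl

theorem VFieldAlong.ext {D D' : VFieldAlong n M A} (h : ∀ ξ, D.at ξ = D'.at ξ) : D = D' :=
  Derivation.ext fun f => SmoothA.ext fun ξ => LinearMap.congr_fun (h ξ) f

theorem VFieldA.along_apply (X : VFieldA n M A) (f : Smooth n M) :
    X.along f = X.1 (prolong n M A f) := rfl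

theorem derivation_apply_eq_zero_of_eqOn
    (Z : Derivation A (SmoothA n M A) (SmoothA n M A)) {ξ : NearPoint n M A}
    {U : Set (NearPoint n M A)} (hU : U ∈ 𝓝 ξ) {φ : SmoothA n M A} (hφ : ∀ ζ ∈ U, φ.1 ζ = 0) :
    (Z φ).1 ξ = 0 := by
  obtain ⟨χ, hχ, h1, h0⟩ := exists_smoothReal_bump hU
  have hzero : ofReal χ hχ * φ = 0 := SmoothA.ext fun ζ => by
    rw [SmoothA.mul_apply, ofReal_apply, SmoothA.zero_apply]
    by_cases hζ : ζ ∈ U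
    · rw [hφ ζ hζ, mul_zero]
    · rw [h0 ζ hζ, map_zero, zero_mul]
  have h := congrArg (fun ψ : SmoothA n M A => ψ.1 ξ) (Z.leibniz (ofReal χ hχ) φ)
  simp only [hzero, map_zero, smul_eq_mul, SmoothA.add_apply, SmoothA.mul_apply, ofReal_apply, h1,
    map_one, one_mul, hφ ξ (mem_of_mem_nhds hU), zero_mul, add_zero, SmoothA.zero_apply] at h
  exact h.symm

/-- Expanding f^A in a basis b_j of A gives Σ b_j Z(φ_j) = 0 with φ_j the real coordinates of f^A.
The Z(φ_j) are real valued, so linear independence over ℝ makes each vanish. -/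
theorem derivation_ofReal_coordFun_eq_zero
    (Z : Derivation A (SmoothA n M A) (SmoothA n M A))
    (hZ : ∀ φ : SmoothA n M A, IsRealValued φ → IsRealValued (Z φ))
    (hZ0 : ∀ f : Smooth n M, Z (prolong n M A f) = 0) (f : Smooth n M) (l : A →ₗ[ℝ] ℝ) :
    Z (ofReal (coordFun f l) (isSmoothReal_coordFun f l)) = 0 := by
  have hj : ∀ j, Z (ofReal (coordFun f ((Module.finBasis ℝ A).coord j))
      (isSmoothReal_coordFun f _)) = 0 := by
    intro j
    refine SmoothA.ext fun ξ => ?_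
    have h := hZ0 f
    rw [SmoothA.eq_sum_ofReal (prolong n M A f), map_sum] at h
    simp only [Derivation.map_smul] at h
    have h' := congrArg (fun ψ : SmoothA n M A => ψ.1 ξ) h
    simp only [SmoothA.sum_apply, SmoothA.smul_apply, SmoothA.zero_apply] at h'
    choose r hr using fun j => hZ _ (isRealValued_ofReal
      (coordFun f ((Module.finBasis ℝ A).coord j)) (isSmoothReal_coordFun f _)) ξ
    have h2 : ∑ j, r j • Module.finBasis ℝ A j = 0 := by
      rw [← h']
      refine Finset.sum_congr rfl fun j _ => ?_
      rw [Algebra.smul_def, hr, mul_comm]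
      rfl
    have h3 := Fintype.linearIndependent_iff.1 (Module.finBasis ℝ A).linearIndependent r h2 j
    rw [← hr, h3, map_zero]
    rfl
  have hsum : ofReal (coordFun f l) (isSmoothReal_coordFun f l) = ∑ j, algebraMap ℝ A
      (l (Module.finBasis ℝ A j)) • ofReal (coordFun f ((Module.finBasis ℝ A).coord j))
        (isSmoothReal_coordFun (A := A) f _) := by
    refine SmoothA.ext fun ξ => ?_
    simp only [SmoothA.sum_apply, SmoothA.smul_apply, ofReal_apply, ← map_mul, ← map_sum]
    congr 1
    change l (ξ.toAlgHom f) = _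
    conv_lhs => rw [← (Module.finBasis ℝ A).sum_repr (ξ.toAlgHom f), map_sum]
    refine Finset.sum_congr rfl fun j _ => ?_
    rw [map_smul, smul_eq_mul, mul_comm]
    rfl
  rw [hsum, map_sum]
  simp only [Derivation.map_smul, hj, smul_zero, Finset.sum_const_zero]

/-- Hadamard at ξ writes a real function near ξ as a constant plus Σ (C_i − C_i(ξ)) ψ_i with Z(C_i)
= 0. The Leibniz rule leaves only terms with the factor C_i − C_i(ξ), zero at ξ. A-linearity covers
A-valued functions. -/
theorem derivation_eq_zero_of_prolong
    (Z : Derivation A (SmoothA n M A) (SmoothA n M A))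
    (hZ : ∀ φ : SmoothA n M A, IsRealValued φ → IsRealValued (Z φ))
    (hZ0 : ∀ f : Smooth n M, Z (prolong n M A f) = 0) : Z = 0 := by
  have hreal : ∀ (φ : NearPoint n M A → ℝ) (hφ : IsSmoothReal φ), Z (ofReal φ hφ) = 0 := by
    intro φ hφ
    refine SmoothA.ext fun ξ => ?_
    obtain ⟨U, hU, hξU, k, f, l, g, hg, h⟩ := hφ ξ
    obtain ⟨G, hG, hgG⟩ := exists_smooth_slope hg (fun i => coordFun (f i) (l i) ξ)
    have hGi : ∀ i, ContDiff ℝ ∞ fun v => G v (Pi.single i 1) := fun i =>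
      hG.clm_apply contDiff_const
    let C : Fin k → SmoothA n M A := fun i =>
      ofReal (coordFun (f i) (l i)) (isSmoothReal_coordFun _ _)
    let K : ℝ → SmoothA n M A := fun c => algebraMap A _ (algebraMap ℝ A c)
    let ψ : SmoothA n M A := K (φ ξ) + ∑ i, (C i - K (coordFun (f i) (l i) ξ)) *
      ofReal _ (isSmoothReal_comp (hGi i) f l)
    have h0 : (Z (ofReal φ hφ - ψ)).1 ξ = 0 := by
      refine derivation_apply_eq_zero_of_eqOn Z (hU.mem_nhds hξU) fun ζ hζ => ?_
      have h1 : φ ζ = φ ξ + ∑ i, (coordFun (f i) (l i) ζ - coordFun (f i) (l i) ξ) *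
          G (fun i => coordFun (f i) (l i) ζ) (Pi.single i 1) := by
        rw [h ζ hζ, h ξ hξU, hgG]
        congr 1
        conv_lhs => rw [pi_eq_sum_univ' ((fun i => coordFun (f i) (l i) ζ)
          - fun i => coordFun (f i) (l i) ξ)]
        rw [map_sum]
        refine Finset.sum_congr rfl fun i _ => ?_
        rw [map_smul, smul_eq_mul]
        congr 2
      have h2 : ψ.1 ζ = algebraMap ℝ A (φ ζ) := by
        rw [h1, map_add, map_sum, SmoothA.add_apply, SmoothA.sum_apply]
        congr 1
        refine Finset.sum_congr rfl fun i _ => ?_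
        rw [map_mul, map_sub]
        rfl
      rw [SmoothA.sub_apply, ofReal_apply, h2, sub_self]
    have hC : ∀ i, Z (C i) = 0 := fun i => derivation_ofReal_coordFun_eq_zero Z hZ hZ0 _ _
    have hK : ∀ c, Z (K c) = 0 := fun c => Z.map_algebraMap _
    have h3 : (Z ψ).1 ξ = 0 := by
      simp only [ψ, map_add, map_sum, Derivation.leibniz, map_sub, hC, hK, sub_zero, smul_zero,
        add_zero, zero_add, SmoothA.sum_apply]
      refine Finset.sum_eq_zero fun i _ => ?_
      rw [smul_eq_mul, SmoothA.mul_apply, SmoothA.sub_apply]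
      exact mul_eq_zero_of_left (sub_self _) _
    rw [map_sub, SmoothA.sub_apply, h3, sub_zero] at h0
    exact h0
  refine Derivation.ext fun φ => ?_
  rw [SmoothA.eq_sum_ofReal φ, map_sum]
  simp only [Derivation.map_smul, hreal, smul_zero, Finset.sum_const_zero, Derivation.coe_zero,
    Pi.zero_apply]

theorem VFieldA.along_injective :
    Function.Injective (VFieldA.along : VFieldA n M A → VFieldAlong n M A) := by
  intro X Y hXY
  refine Subtype.ext (sub_eq_zero.1 (derivation_eq_zero_of_prolong (X.1 - Y.1) ?_ ?_))
  · intro φ hφ ξ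
    obtain ⟨r, hr⟩ := X.2 φ hφ ξ
    obtain ⟨s, hs⟩ := Y.2 φ hφ ξ
    exact ⟨r - s, by rw [map_sub, hr, hs]; rfl⟩
  · intro f
    rw [Derivation.sub_apply, sub_eq_zero]
    exact DFunLike.congr_fun hXY f

variable [IsManifold (𝓡 n) ∞ M] [T2Space M]

theorem VFieldA.along_surjective (ε : A →ₐ[ℝ] ℝ) :
    Function.Surjective (VFieldA.along : VFieldA n M A → VFieldAlong n M A) := by
  intro D
  choose γ hγ0 hγ using fun ξ : NearPoint n M A => ξ.exists_curve ε (D.isDerivAlong_at ξ)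
  have hd : ∀ (φ : SmoothA n M A) (ξ : NearPoint n M A),
      ∃ a, HasDerivA (fun t => φ.1 (γ ξ t)) a := by
    intro φ ξ
    choose U hU hξU k f l g hg h using fun j => φ.2 ((Module.finBasis ℝ A).coord j) ξ
    have hj := fun j => IsSmoothReal.hasDerivAt_comp (hU j) (hξU j) (hg j) (h j) (hγ0 ξ) (hγ ξ)
    choose r hr using fun j => (⟨_, hj j⟩ : ∃ r, HasDerivAt
      (fun t => (Module.finBasis ℝ A).coord j (φ.1 (γ ξ t))) r 0)
    refine ⟨∑ j, r j • Module.finBasis ℝ A j, hasDerivA_of_coord fun j => ?_⟩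
    convert hr j using 1
    rw [Module.Basis.coord_apply, Module.Basis.repr_sum_self]
  choose d hd using hd
  have hsmooth : ∀ (φ : SmoothA n M A) (l : A →ₗ[ℝ] ℝ), IsSmoothReal fun ξ => l (d φ ξ) := by
    intro φ l
    refine isSmoothReal_of_locally fun ξ => ?_
    obtain ⟨U, hU, hξU, k, f, l', g, hg, h⟩ := φ.2 l ξ
    have hgi : ∀ i, ContDiff ℝ ∞ fun v => fderiv ℝ g v (Pi.single i 1) := fun i =>
      (hg.fderiv_right (by simp)).clm_apply contDiff_const
    refine ⟨U, hU, hξU, _, IsSmoothReal.sum Finset.univ fun i =>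
      (isSmoothReal_comp (hgi i) f l').mul ((D (f i)).2 (l' i)), fun ζ hζ => ?_⟩
    exact (hd φ ζ l).unique (IsSmoothReal.hasDerivAt_comp hU hζ hg h (hγ0 ζ) (hγ ζ))
  let X : Derivation A (SmoothA n M A) (SmoothA n M A) := Derivation.mk'
    { toFun := fun φ => ⟨d φ, hsmooth φ⟩
      map_add' := fun φ ψ => SmoothA.ext fun ξ =>
        (hd (φ + ψ) ξ).unique ((hd φ ξ).add (hd ψ ξ))
      map_smul' := fun a φ => SmoothA.ext fun ξ =>
        (hd (a • φ) ξ).unique ((hd φ ξ).map (LinearMap.mulLeft ℝ a)) }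
    fun φ ψ => SmoothA.ext fun ξ => by
      have := (hd (φ * ψ) ξ).unique ((hd φ ξ).mul (hd ψ ξ))
      rw [hγ0 ξ] at this
      exact this
  refine ⟨⟨X, fun φ hφ ξ => ?_⟩, Derivation.ext fun f => SmoothA.ext fun ξ => ?_⟩
  -- A real-valued φ is ε(φ)·1, hence so is its derivative along each curve.
  · have h1 : ∀ ζ, φ.1 ζ = ε (φ.1 ζ) • (1 : A) := fun ζ => by
      obtain ⟨r, hr⟩ := hφ ζ
      rw [← hr, AlgHom.commutes, Algebra.algebraMap_eq_smul_one]
      rfl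
    refine ⟨ε (d φ ξ), ?_⟩
    rw [Algebra.algebraMap_eq_smul_one]
    refine HasDerivA.unique ?_ (hd φ ξ)
    exact (hasDerivA_smul (hd φ ξ ε.toLinearMap) (1 : A)).congr
      (Eventually.of_forall fun t => h1 _)
  · exact (hd (prolong n M A f) ξ).unique (hγ ξ f)

end BundleFunctions

/-! ### Local expressions of forms -/

section AlternatingMaps

variable {R V W : Type*} [CommSemiring R] [AddCommMonoid V] [Module R V]

section Monoid

variable [AddCommMonoid W] [Module R W]

/-- An alternating map of degree `1` as a linear map. -/
def altLin (η : V [⋀^Fin 1]→ₗ[R] W) : V →ₗ[R] W where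
  toFun x := η ![x]
  map_add' x y := η.toMultilinearMap.cons_add ![] x y
  map_smul' c x := η.toMultilinearMap.cons_smul ![] c x

/-- An alternating map of degree `2` as a bilinear map. -/
def altBilin (β : V [⋀^Fin 2]→ₗ[R] W) : V →ₗ[R] V →ₗ[R] W :=
  LinearMap.mk₂ R (fun x y => β ![x, y])
    (fun x x' y => β.toMultilinearMap.cons_add ![y] x x')
    (fun c x y => β.toMultilinearMap.cons_smul ![y] c x)
    (fun x y y' => (altLin (β.curryLeft x)).map_add y y')
    (fun c x y => (altLin (β.curryLeft x)).map_smul c y)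

theorem altBilin_apply (β : V [⋀^Fin 2]→ₗ[R] W) (x y : V) : altBilin β x y = β ![x, y] := rfl

end Monoid

theorem altBilin_swap [AddCommGroup W] [Module R W] (β : V [⋀^Fin 2]→ₗ[R] W) (x y : V) :
    altBilin β x y = -altBilin β y x := by
  have h : altBilin β (x + y) (x + y) = 0 := β.map_eq_zero_of_eq _ (i := 0) (j := 1) rfl zero_ne_one
  have hx : altBilin β x x = 0 := β.map_eq_zero_of_eq _ (i := 0) (j := 1) rfl zero_ne_one
  have hy : altBilin β y y = 0 := β.map_eq_zero_of_eq _ (i := 0) (j := 1) rfl zero_ne_one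
  simp only [map_add, LinearMap.add_apply, hx, hy, zero_add, add_zero] at h
  exact eq_neg_of_add_eq_zero_right h

omit [AddCommMonoid V] in
theorem vec_two_eta (v : Fin 2 → V) : ![v 0, v 1] = v := by
  ext i
  fin_cases i <;> rfl

end AlternatingMaps

/-! ### Locality of forms, and their prolongation. -/

section LocalForms

open Filter Topology IsLocalRing

variable {n : ℕ} {M : Type*} [TopologicalSpace M] [ChartedSpace (EuclideanSpace ℝ (Fin n)) M]
  {A : Type*} [CommRing A] [Algebra ℝ A] [IsLocalRing A]

theorem Smooth.sum_apply {ι : Type*} (s : Finset ι) (f : ι → Smooth n M) (x : M) :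
    (∑ i ∈ s, f i) x = ∑ i ∈ s, f i x :=
  map_sum (evalHom x) f s

theorem IsNear.augmentation {ξ : Smooth n M →ₐ[ℝ] A} {x : M} (hξ : IsNear ξ x) (ε : A →ₐ[ℝ] ℝ)
    (f : Smooth n M) : ε (ξ f) = f x := by
  have := (augmentation_eq_zero_iff ε).2 (hξ f)
  rw [map_sub, AlgHom.commutes] at this
  exact sub_eq_zero.1 this

variable [IsManifold (𝓡 n) ∞ M] [T2Space M]

/-- The real part ε(ζ(σ)) is the value of the bump σ at the base point of ζ; where it is nonzero,
that base point lies in U. -/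
theorem near_mem_nhds (ε : A →ₐ[ℝ] ℝ) {U : Set M} (hU : IsOpen U) {ξ : NearPoint n M A} {x : M}
    (hξ : IsNear ξ.toAlgHom x) (hx : x ∈ U) :
    {ζ : NearPoint n M A | ∀ y, IsNear ζ.toAlgHom y → y ∈ U} ∈ 𝓝 ξ := by
  obtain ⟨σ, hσ, hσ'⟩ := exists_bump (n := n) (hU.mem_nhds hx)
  have h1 : coordFun σ ε.toLinearMap ξ ≠ 0 := by
    have : coordFun σ ε.toLinearMap ξ = σ x := hξ.augmentation ε σ
    rw [this, hσ.self_of_nhds]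
    exact one_ne_zero
  filter_upwards [(continuous_coordFun σ ε.toLinearMap).continuousAt.eventually_ne h1]
    with ζ hζ y hy
  by_contra hyU
  exact hζ ((hy.augmentation ε σ).trans (hσ' y hyU).self_of_nhds)

omit [IsManifold (𝓡 n) ∞ M] [T2Space M] in
theorem VField.sum_apply {ι : Type*} (s : Finset ι) (X : ι → VField n M) (f : Smooth n M)
    (x : M) : (∑ i ∈ s, X i) f x = ∑ i ∈ s, X i f x := by
  rw [← Derivation.coeFnAddMonoidHom_apply, map_sum, Finset.sum_apply, Smooth.sum_apply]
  rfl

theorem VField.linear_apply_eq_zero (L : VField n M →ₗ[Smooth n M] Smooth n M) {U : Set M}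
    (hU : IsOpen U) {θ : VField n M} (hθ : ∀ z ∈ U, θ.pull (evalHom z) = 0) {y : M} (hy : y ∈ U) :
    L θ y = 0 := by
  obtain ⟨σ, hσ, hσ'⟩ := exists_bump (n := n) (hU.mem_nhds hy)
  have h0 : σ • θ = 0 := by
    ext f z
    change σ z * θ f z = 0
    by_cases hz : z ∈ U
    · rw [show θ f z = 0 from LinearMap.congr_fun (hθ z hz) f, mul_zero]
    · rw [(hσ' z hz).self_of_nhds, zero_mul]
  have h1 := congrArg (fun f : Smooth n M => f y) (L.map_smul σ θ)
  rw [h0, map_zero] at h1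
  have h2 : 0 = σ y * L θ y := h1
  rw [hσ.self_of_nhds, one_mul] at h2
  exact h2.symm

theorem LocalFrame.linear_apply {x₀ : M} (F : LocalFrame n x₀)
    (L : VField n M →ₗ[Smooth n M] Smooth n M) (θ : VField n M) {y : M} (hy : y ∈ F.U) :
    L θ y = ∑ i, θ (F.coord i) y * L (F.field i) y := by
  have h := VField.linear_apply_eq_zero L F.isOpen_U
    (θ := θ - ∑ i, θ (F.coord i) • F.field i) (fun z hz => by
      refine F.deriv_eq_zero hz (isNear_evalHom z) (VField.isDerivAlong_pull _ _) fun j => ?_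
      rw [VField.pull_apply, Derivation.sub_apply, map_sub, sub_eq_zero, evalHom_apply,
        evalHom_apply, VField.sum_apply]
      change θ (F.coord j) z = ∑ i, θ (F.coord i) z * F.field i (F.coord j) z
      simp [F.field_coord z hz]) hy
  rw [map_sub, map_sum] at h
  simp only [map_smul] at h
  have h' : L θ y - (∑ i, θ (F.coord i) • L (F.field i) : Smooth n M) y = 0 := h
  rw [Smooth.sum_apply, sub_eq_zero] at h'
  exact h'

theorem LocalFrame.linear_bracket {x₀ : M} (F : LocalFrame n x₀)
    (L : VField n M →ₗ[Smooth n M] Smooth n M) (i j : Fin n) {y : M} (hy : y ∈ F.U) :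
    L ⁅F.field i, F.field j⁆ y = 0 := by
  rw [F.linear_apply L _ hy]
  refine Finset.sum_eq_zero fun k _ => mul_eq_zero_of_left ?_ _
  rw [Derivation.commutator_apply]
  have h : ∀ i j k : Fin n, F.field i (F.field j (F.coord k)) y = 0 := fun i j k =>
    (F.field i).eq_zero_of_const (if j = k then 1 else 0) (by
      filter_upwards [F.isOpen_U.mem_nhds hy] with z hz
      exact F.field_coord z hz j k)
  change F.field i (F.field j (F.coord k)) y - F.field j (F.field i (F.coord k)) y = 0
  rw [h, h, sub_self]

variable [Module.Finite ℝ A]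

instance : SMul (SmoothA n M A) (VFieldAlong n M A) := Derivation.instModule.toSMul

theorem VFieldAlong.linear_apply_congr (L : VFieldAlong n M A →ₗ[SmoothA n M A] SmoothA n M A)
    {U : Set M} (hU : IsOpen U) {D D' : VFieldAlong n M A}
    (hD : ∀ (ζ : NearPoint n M A) (z : M), IsNear ζ.toAlgHom z → z ∈ U → D.at ζ = D'.at ζ)
    {ξ : NearPoint n M A} {y : M} (hξ : IsNear ξ.toAlgHom y) (hy : y ∈ U) :
    (L D).1 ξ = (L D').1 ξ := by
  obtain ⟨σ, hσ, hσ'⟩ := exists_bump (n := n) (hU.mem_nhds hy)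
  have h0 : prolong n M A σ • D = prolong n M A σ • D' := by
    refine VFieldAlong.ext fun ζ => LinearMap.ext fun f => ?_
    obtain ⟨z, hz⟩ := ζ.exists_base
    replace hz : IsNear ζ.toAlgHom z := hz
    change ζ.toAlgHom σ * D.at ζ f = ζ.toAlgHom σ * D'.at ζ f
    by_cases hzU : z ∈ U
    · rw [hD ζ z hz hzU]
    · rw [hz.eq_zero (hσ' z hzU), zero_mul, zero_mul]
  have h1 := congrArg (fun ψ : SmoothA n M A => ψ.1 ξ) (congrArg L h0)
  simp only [L.map_smul] at h1
  have h2 : ξ.toAlgHom σ * (L D).1 ξ = ξ.toAlgHom σ * (L D').1 ξ := h1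
  rwa [hξ.congr (g := 1) hσ, map_one, one_mul, one_mul] at h2

omit [IsManifold (𝓡 n) ∞ M] [T2Space M] in
theorem VFieldAlong.sum_apply {ι : Type*} (s : Finset ι) (D : ι → VFieldAlong n M A)
    (f : Smooth n M) : (∑ i ∈ s, D i) f = ∑ i ∈ s, D i f := by
  rw [← Derivation.coeFnAddMonoidHom_apply, map_sum, Finset.sum_apply]
  rfl

theorem IsDerivAlong.eq_sum {x₀ : M} (F : LocalFrame n x₀) {y : M} (hy : y ∈ F.U)
    {ξ : Smooth n M →ₐ[ℝ] A} (hξ : IsNear ξ y) {D : Smooth n M →ₗ[ℝ] A}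
    (hD : IsDerivAlong ξ D) : D = ∑ i, D (F.coord i) • (F.field i).pull ξ := by
  refine F.deriv_ext hy hξ hD (fun f g => ?_) fun j => ?_
  · simp only [LinearMap.sum_apply, LinearMap.smul_apply, smul_eq_mul,
      VField.isDerivAlong_pull _ ξ f g, Finset.mul_sum, ← Finset.sum_add_distrib]
    exact Finset.sum_congr rfl fun i _ => by ring
  · simp [LinearMap.sum_apply, VField.pull_apply, F.map_field_coord hy hξ]

/-- Over U every derivation along f ↦ f^A equals Σ D(x_i) ∂_i^A, and linear maps over C^∞(M^A, A)
are local by multiplication with σ^A. -/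
theorem LocalFrame.linearA_apply {x₀ : M} (F : LocalFrame n x₀)
    (L : VFieldAlong n M A →ₗ[SmoothA n M A] SmoothA n M A) (D : VFieldAlong n M A)
    {ξ : NearPoint n M A} {y : M} (hξ : IsNear ξ.toAlgHom y) (hy : y ∈ F.U) :
    (L D).1 ξ = ∑ i, (D (F.coord i)).1 ξ * (L (prolongAlong A (F.field i))).1 ξ := by
  have h := VFieldAlong.linear_apply_congr L F.isOpen_U (D := D)
    (D' := ∑ i, D (F.coord i) • prolongAlong A (F.field i)) (fun ζ z hζ hz => by
      ext f
      have h1 := LinearMap.congr_fun ((D.isDerivAlong_at ζ).eq_sum F hz hζ) f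
      rw [LinearMap.sum_apply] at h1
      rw [VFieldAlong.at_apply (∑ i, _), VFieldAlong.sum_apply, SmoothA.sum_apply]
      exact h1) hξ hy
  rw [h, map_sum, SmoothA.sum_apply]
  refine Finset.sum_congr rfl fun i _ => ?_
  rw [map_smul]
  rfl

/-! ### Prolongation of forms of degree two -/

theorem FormA.ext_prolongAlong {β β' : FormA n M A 2}
    (h : ∀ θ : Fin 2 → VField n M, β (fun i => prolongAlong A (θ i)) =
      β' (fun i => prolongAlong A (θ i))) : β = β' := by
  have h' : ∀ θ θ' : VField n M, altBilin β (prolongAlong A θ) (prolongAlong A θ') =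
      altBilin β' (prolongAlong A θ) (prolongAlong A θ') := fun θ θ' => by
    have := h ![θ, θ']
    rw [← vec_two_eta (fun i => prolongAlong A (![θ, θ'] i))] at this
    exact this
  ext v : 1
  rw [← vec_two_eta v, ← altBilin_apply, ← altBilin_apply]
  refine SmoothA.ext fun ξ => ?_
  obtain ⟨y, hξ⟩ := ξ.exists_base
  replace hξ : IsNear ξ.toAlgHom y := hξ
  obtain ⟨F⟩ := nonempty_localFrame (n := n) y
  have key : ∀ β : FormA n M A 2, (altBilin β (v 0) (v 1)).1 ξ =
      ∑ i, (v 1 (F.coord i)).1 ξ * ∑ j, (v 0 (F.coord j)).1 ξ *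
        (altBilin β (prolongAlong A (F.field j)) (prolongAlong A (F.field i))).1 ξ := by
    intro β
    rw [F.linearA_apply _ _ hξ F.mem_U]
    refine Finset.sum_congr rfl fun i _ => ?_
    congr 1
    exact F.linearA_apply ((altBilin β).flip _) _ hξ F.mem_U
  rw [key, key]
  simp only [h']

/-- The value at a near point `ξ` of the prolongation of a `2`-form, in a local frame. -/
def LocalFrame.formValue {x₀ : M} (F : LocalFrame n x₀) (Ω : Form n M 2)
    (ξ : Smooth n M →ₐ[ℝ] A) : (Smooth n M →ₗ[ℝ] A) →ₗ[A] (Smooth n M →ₗ[ℝ] A) →ₗ[A] A :=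
  LinearMap.mk₂ A (fun D D' => ∑ i, ∑ j, D (F.coord i) * D' (F.coord j) *
      ξ (altBilin Ω (F.field i) (F.field j)))
    (fun D D' E => by simp only [LinearMap.add_apply, add_mul, Finset.sum_add_distrib])
    (fun c D E => by
      simp only [LinearMap.smul_apply, smul_eq_mul, mul_assoc, Finset.mul_sum])
    (fun D E E' => by simp only [LinearMap.add_apply, mul_add, add_mul, Finset.sum_add_distrib])
    (fun c D E => by
      simp only [LinearMap.smul_apply, smul_eq_mul, mul_left_comm _ c, mul_assoc, Finset.mul_sum])

omit [IsLocalRing A] [IsManifold (𝓡 n) ∞ M] [T2Space M] [Module.Finite ℝ A] in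
theorem LocalFrame.formValue_apply {x₀ : M} (F : LocalFrame n x₀) (Ω : Form n M 2)
    (ξ : Smooth n M →ₐ[ℝ] A) (D D' : Smooth n M →ₗ[ℝ] A) : F.formValue Ω ξ D D' =
      ∑ i, ∑ j, D (F.coord i) * D' (F.coord j) * ξ (altBilin Ω (F.field i) (F.field j)) := rfl

omit [IsManifold (𝓡 n) ∞ M] [T2Space M] [Module.Finite ℝ A] in
theorem LocalFrame.formValue_self {x₀ : M} (F : LocalFrame n x₀) (Ω : Form n M 2)
    (ξ : Smooth n M →ₐ[ℝ] A) (D : Smooth n M →ₗ[ℝ] A) : F.formValue Ω ξ D D = 0 := by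
  have h : F.formValue Ω ξ D D = -F.formValue Ω ξ D D := by
    conv_lhs => rw [F.formValue_apply, Finset.sum_comm]
    rw [F.formValue_apply, ← Finset.sum_neg_distrib]
    refine Finset.sum_congr rfl fun i _ => ?_
    rw [← Finset.sum_neg_distrib]
    refine Finset.sum_congr rfl fun j _ => ?_
    rw [altBilin_swap, map_neg]
    ring
  have h2 : (2 : ℝ) • F.formValue Ω ξ D D = 0 := by
    rw [two_smul]
    exact add_eq_zero_iff_eq_neg.2 h
  exact (smul_eq_zero.1 h2).resolve_left two_ne_zero

omit [Module.Finite ℝ A] in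
theorem LocalFrame.formValue_pull {x₀ : M} (F : LocalFrame n x₀) (Ω : Form n M 2)
    {ξ : Smooth n M →ₐ[ℝ] A} {y : M} (hξ : IsNear ξ y) (hy : y ∈ F.U) (θ θ' : VField n M) :
    F.formValue Ω ξ (θ.pull ξ) (θ'.pull ξ) = ξ (altBilin Ω θ θ') := by
  have h : ∀ᶠ z in 𝓝 y, altBilin Ω θ θ' z = (∑ i, ∑ j, θ (F.coord i) * θ' (F.coord j) *
      altBilin Ω (F.field i) (F.field j) : Smooth n M) z := by
    filter_upwards [F.isOpen_U.mem_nhds hy] with z hz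
    rw [F.linear_apply _ _ hz, Smooth.sum_apply]
    simp only [Smooth.sum_apply]
    rw [Finset.sum_comm]
    refine Finset.sum_congr rfl fun i _ => ?_
    have h1 := F.linear_apply ((altBilin Ω).flip (F.field i)) θ hz
    simp only [LinearMap.flip_apply] at h1
    rw [h1, Finset.mul_sum]
    refine Finset.sum_congr rfl fun j _ => ?_
    change _ = θ (F.coord j) z * θ' (F.coord i) z * altBilin Ω (F.field j) (F.field i) z
    ring
  rw [hξ.congr h, F.formValue_apply]
  simp only [map_sum, map_mul, VField.pull_apply]

/-- Both sides are A-bilinear and equal ξ(Ω(θ, θ')) on the derivations f ↦ ξ(θ f), which span all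
derivations along ξ. -/
theorem LocalFrame.formValue_eq {x₀ x₁ : M} (F : LocalFrame n x₀) (F' : LocalFrame n x₁)
    (Ω : Form n M 2) {ξ : Smooth n M →ₐ[ℝ] A} {y : M} (hξ : IsNear ξ y) (hy : y ∈ F.U)
    (hy' : y ∈ F'.U) {D D' : Smooth n M →ₗ[ℝ] A} (hD : IsDerivAlong ξ D)
    (hD' : IsDerivAlong ξ D') : F'.formValue Ω ξ D D' = F.formValue Ω ξ D D' := by
  rw [hD.eq_sum F hy hξ, hD'.eq_sum F hy hξ]
  simp only [map_sum, map_smul, LinearMap.sum_apply, LinearMap.smul_apply,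
    F.formValue_pull Ω hξ hy, F'.formValue_pull Ω hξ hy']

theorem exists_isFormProlongation (ε : A →ₐ[ℝ] ℝ) (Ω : Form n M 2) :
    ∃ ΩA : FormA n M A 2, IsFormProlongation Ω ΩA := by
  have F : ∀ x : M, LocalFrame n x := fun x => (nonempty_localFrame x).some
  choose π hπ using fun ξ : NearPoint n M A => ξ.exists_base
  replace hπ : ∀ ξ : NearPoint n M A, IsNear ξ.toAlgHom (π ξ) := hπ
  let B : ∀ ξ : NearPoint n M A, (Smooth n M →ₗ[ℝ] A) →ₗ[A] (Smooth n M →ₗ[ℝ] A) →ₗ[A] A :=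
    fun ξ => (F (π ξ)).formValue Ω ξ.toAlgHom
  have hsmooth : ∀ (v : Fin 2 → VFieldAlong n M A) (l : A →ₗ[ℝ] ℝ),
      IsSmoothReal fun ξ => l (B ξ ((v 0).at ξ) ((v 1).at ξ)) := by
    intro v l
    refine isSmoothReal_of_locally fun ξ => ?_
    -- The frame used at ζ varies with its base point, without any continuity; frame independence
    -- replaces it near ξ by the single frame at π ξ.
    have hN := near_mem_nhds ε (F (π ξ)).isOpen_U (hπ ξ) (F (π ξ)).mem_U
    obtain ⟨V, hVN, hV, hξV⟩ := mem_nhds_iff.1 hN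
    let ψ : SmoothA n M A := ∑ i, ∑ j, v 0 ((F (π ξ)).coord i) * v 1 ((F (π ξ)).coord j) *
      prolong n M A (altBilin Ω ((F (π ξ)).field i) ((F (π ξ)).field j))
    refine ⟨V, hV, hξV, fun ζ => l (ψ.1 ζ), ψ.2 l, fun ζ hζ => ?_⟩
    congr 1
    refine ((F (π ξ)).formValue_eq (F (π ζ)) Ω (hπ ζ) (hVN hζ _ (hπ ζ)) (F (π ζ)).mem_U
      ((v 0).isDerivAlong_at ζ) ((v 1).isDerivAlong_at ζ)).trans ?_
    simp only [ψ, SmoothA.sum_apply]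
    rfl
  refine ⟨{ toFun := fun v => ⟨fun ξ => B ξ ((v 0).at ξ) ((v 1).at ξ), hsmooth v⟩
            map_update_add' := ?_
            map_update_smul' := ?_
            map_eq_zero_of_eq' := ?_ }, ?_⟩
  · intro _ v i D D'
    refine SmoothA.ext fun ξ => ?_
    have hadd : (D + D').at ξ = D.at ξ + D'.at ξ := rfl
    rw [SmoothA.add_apply]
    fin_cases i
    · simp [hadd]
    · simp [hadd]
  · intro _ v i φ D
    refine SmoothA.ext fun ξ => ?_
    have hsmul : (φ • D).at ξ = φ.1 ξ • D.at ξ := rfl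
    rw [smul_eq_mul, SmoothA.mul_apply]
    fin_cases i
    · simp [hsmul]
    · simp [hsmul]
  · intro v i j hij hne
    refine SmoothA.ext fun ξ => ?_
    have h01 : v 0 = v 1 := by
      fin_cases i <;> fin_cases j <;> first | exact absurd rfl hne | exact hij | exact hij.symm
    change B ξ ((v 0).at ξ) ((v 1).at ξ) = 0
    rw [h01]
    exact LocalFrame.formValue_self _ _ _ _
  · intro θ
    refine SmoothA.ext fun ξ => ?_
    refine ((F (π ξ)).formValue_pull Ω (hπ ξ) (F (π ξ)).mem_U (θ 0) (θ 1)).trans ?_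
    rw [altBilin_apply, vec_two_eta, prolong_apply]

/-! ### Prolongation of closed forms of degree one -/

omit [IsManifold (𝓡 n) ∞ M] [T2Space M] in
theorem along_eq_prolongAlong_iff {θ : VField n M} {Θ : VFieldA n M A} :
    Θ.along = prolongAlong A θ ↔ IsFieldProlongation θ Θ :=
  ⟨fun h f => DFunLike.congr_fun h f, fun h => Derivation.ext h⟩

omit [IsManifold (𝓡 n) ∞ M] [T2Space M] in
theorem bracket_along_apply (Y Z : VFieldA n M A) (f : Smooth n M) :
    (⁅Y, Z⁆ : VFieldA n M A).along f = Y.1 (Z.along f) - Z.1 (Y.along f) := by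
  change (⁅Y.1, Z.1⁆ : Derivation A (SmoothA n M A) (SmoothA n M A)) (prolong n M A f) = _
  rw [Derivation.commutator_apply]
  rfl

omit [IsManifold (𝓡 n) ∞ M] [T2Space M] in
-- Evaluation at x, followed by ℝ → A, is a near point at which f^A takes the value f(x).
theorem prolong_injective : Function.Injective (prolong n M A) := by
  refine (injective_iff_map_eq_zero _).2 fun f hf => ?_
  ext x
  have h := congrArg (fun ψ : SmoothA n M A => ψ.1 ⟨evalHomA A x, x, isNear_evalHomA x⟩) hf
  exact (algebraMap ℝ A).injective (h.trans (map_zero _).symm)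

omit [IsManifold (𝓡 n) ∞ M] [T2Space M] in
theorem dA₁_prolongation {α : Form n M 1} {η : FormA n M A 1}
    (hη : ∀ θ, η ![prolongAlong A θ] = prolong n M A (α ![θ])) {θ θ' : VField n M}
    {Y Z : VFieldA n M A} (hY : IsFieldProlongation θ Y) (hZ : IsFieldProlongation θ' Z) :
    dA₁ η Y Z = prolong n M A (d₁ α θ θ') := by
  have hYZ : IsFieldProlongation ⁅θ, θ'⁆ (⁅Y, Z⁆ : VFieldA n M A) := fun f => by
    refine (bracket_along_apply Y Z f).trans ?_
    rw [VFieldA.along_apply, VFieldA.along_apply, hY f, hZ f, hY, hZ, ← map_sub,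
      Derivation.commutator_apply]
  rw [dA₁, along_eq_prolongAlong_iff.2 hY, along_eq_prolongAlong_iff.2 hZ,
    along_eq_prolongAlong_iff.2 hYZ, hη, hη, hη, hY, hZ, d₁, map_sub, map_sub]

/-- Reduction to prolonged fields by linearity is not available: the field attached to φ • X does
not act on A-valued functions as φ times X. Hence the computation in coordinates with η(W) = Σ
W(x_i) a_i^A. The second derivatives of the x_i cancel against the bracket, and the rest cancels by
symmetry of ∂_j a_i. -/
theorem dA₁_eq_zero (ε : A →ₐ[ℝ] ℝ) {α : Form n M 1} {η : FormA n M A 1}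
    (hη : ∀ θ, η ![prolongAlong A θ] = prolong n M A (α ![θ]))
    (hα : ∀ θ θ', d₁ α θ θ' = 0) (Y Z : VFieldA n M A) : dA₁ η Y Z = 0 := by
  refine SmoothA.ext fun ξ => ?_
  obtain ⟨y, hξ⟩ := ξ.exists_base
  replace hξ : IsNear ξ.toAlgHom y := hξ
  obtain ⟨F⟩ := nonempty_localFrame (n := n) y
  let a : Fin n → Smooth n M := fun i => α ![F.field i]
  have hloc : ∀ (D : VFieldAlong n M A) (ζ : NearPoint n M A) (z : M), IsNear ζ.toAlgHom z →
      z ∈ F.U → (η ![D]).1 ζ = ∑ i, (D (F.coord i)).1 ζ * ζ.toAlgHom (a i) := by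
    intro D ζ z hζ hz
    refine (F.linearA_apply (altLin η) D hζ hz).trans ?_
    refine Finset.sum_congr rfl fun i _ => ?_
    congr 1
    exact congrArg (fun ψ : SmoothA n M A => ψ.1 ζ) (hη (F.field i))
  have hder : ∀ X W : VFieldA n M A, (X.1 (η ![W.along])).1 ξ =
      ∑ i, ((X.1 (W.along (F.coord i))).1 ξ * ξ.toAlgHom (a i) + ∑ j,
        (W.along (F.coord i)).1 ξ * (X.along (F.coord j)).1 ξ * ξ.toAlgHom (F.field j (a i))) := by
    intro X W
    have h0 := derivation_apply_eq_zero_of_eqOn X.1 (near_mem_nhds ε F.isOpen_U hξ F.mem_U)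
      (φ := η ![W.along] - ∑ i, W.along (F.coord i) * prolong n M A (a i)) (fun ζ hζ => by
        obtain ⟨z, hz⟩ := ζ.exists_base
        rw [SmoothA.sub_apply, SmoothA.sum_apply, hloc W.along ζ z hz (hζ z hz)]
        exact sub_self _)
    rw [map_sub, SmoothA.sub_apply, sub_eq_zero] at h0
    rw [h0, map_sum, SmoothA.sum_apply]
    refine Finset.sum_congr rfl fun i _ => ?_
    have h1 := LinearMap.congr_fun ((X.along.isDerivAlong_at ξ).eq_sum F F.mem_U hξ) (a i)
    rw [LinearMap.sum_apply] at h1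
    have h2 : (X.1 (prolong n M A (a i))).1 ξ =
      ∑ j, (X.along (F.coord j)).1 ξ * ξ.toAlgHom (F.field j (a i)) := h1
    rw [Derivation.leibniz, smul_eq_mul, smul_eq_mul, SmoothA.add_apply, SmoothA.mul_apply,
      SmoothA.mul_apply, h2, prolong_apply, Finset.mul_sum, add_comm]
    congr 1
    · ring
    · exact Finset.sum_congr rfl fun j _ => by ring
  -- Closedness of α on the pair ∂_j, ∂_i, whose bracket contributes nothing on U.
  have hcl : ∀ i j, ξ.toAlgHom (F.field j (a i)) = ξ.toAlgHom (F.field i (a j)) := by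
    intro i j
    refine hξ.congr ?_
    filter_upwards [F.isOpen_U.mem_nhds F.mem_U] with z hz
    have h1 := congrArg (fun f : Smooth n M => f z) (hα (F.field j) (F.field i))
    have h2 : F.field j (a i) z - F.field i (a j) z
      - altLin α ⁅F.field j, F.field i⁆ z = 0 := h1
    rw [F.linear_bracket _ _ _ hz, sub_zero] at h2
    exact sub_eq_zero.1 h2
  rw [dA₁, SmoothA.sub_apply, SmoothA.sub_apply, hder, hder, hloc _ ξ y hξ F.mem_U,
    SmoothA.zero_apply]
  simp only [bracket_along_apply, SmoothA.sub_apply, Finset.sum_add_distrib, sub_mul,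
    Finset.sum_sub_distrib]
  have hsymm : ∑ i, ∑ j, (Z.along (F.coord i)).1 ξ * (Y.along (F.coord j)).1 ξ *
      ξ.toAlgHom (F.field j (a i)) = ∑ i, ∑ j, (Y.along (F.coord i)).1 ξ *
        (Z.along (F.coord j)).1 ξ * ξ.toAlgHom (F.field j (a i)) := by
    rw [Finset.sum_comm]
    refine Finset.sum_congr rfl fun i _ => Finset.sum_congr rfl fun j _ => ?_
    rw [hcl i j]
    ring
  rw [hsymm]
  ring

end LocalForms

/-! ### Locally Hamiltonian fields -/

theorem isLocallyHamiltonian_iff {n : ℕ} {M : Type*} [TopologicalSpace M]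
    [ChartedSpace (EuclideanSpace ℝ (Fin n)) M] [IsManifold (𝓡 n) ∞ M] [T2Space M]
    {A : Type*} [CommRing A] [Algebra ℝ A] [IsLocalRing A] [Module.Finite ℝ A]
    (ε : A →ₐ[ℝ] ℝ) {Ω : Form n M 2} {θ : VField n M} {Θ : VFieldA n M A} {ΩA : FormA n M A 2}
    (hΘ : IsFieldProlongation θ Θ) (hΩA : IsFormProlongation Ω ΩA) :
    IsLocallyHamiltonian Ω θ ↔ IsLocallyHamiltonianA ΩA Θ := by
  have hη : ∀ θ', ΩA.curryLeft Θ.along ![prolongAlong A θ'] =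
      prolong n M A (Ω.curryLeft θ ![θ']) := fun θ' => by
    have h := hΩA ![θ, θ']
    rw [← vec_two_eta (fun i => prolongAlong A (![θ, θ'] i))] at h
    rw [along_eq_prolongAlong_iff.2 hΘ]
    exact h
  refine ⟨fun h Y Z => dA₁_eq_zero ε hη h Y Z, fun h X Y => ?_⟩
  -- To test closedness on M it is enough to evaluate on the prolongations of X and Y.
  obtain ⟨X', hX'⟩ := VFieldA.along_surjective ε (prolongAlong A X)
  obtain ⟨Y', hY'⟩ := VFieldA.along_surjective ε (prolongAlong A Y)
  have h1 := h X' Y'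
  rw [dA₁_prolongation hη (along_eq_prolongAlong_iff.1 hX') (along_eq_prolongAlong_iff.1 hY')] at h1
  exact prolong_injective (h1.trans (map_zero _).symm)

end Weil

end

theorem mainTheorem2 {n : ℕ} {M : Type*} [TopologicalSpace M]
    [ChartedSpace (EuclideanSpace ℝ (Fin n)) M] [IsManifold (𝓡 n) ∞ M]
    [T2Space M] [ParacompactSpace M]
    {A : Type*} [CommRing A] [Algebra ℝ A] [Module.Finite ℝ A] [IsLocalRing A]
    (hA : Module.finrank ℝ (A ⧸ IsLocalRing.maximalIdeal A) = 1)
    (Ω : Weil.Form n M 2) (hΩ : Weil.IsSymplectic Ω) (θ : Weil.VField n M) :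
    Function.Bijective
        (Weil.VFieldA.along : Weil.VFieldA n M A → Weil.VFieldAlong n M A) ∧
      (∃! Θ : Weil.VFieldA n M A, Weil.IsFieldProlongation θ Θ) ∧
      (∃! ΩA : Weil.FormA n M A 2, Weil.IsFormProlongation Ω ΩA) ∧
      ∀ (Θ : Weil.VFieldA n M A) (ΩA : Weil.FormA n M A 2),
        Weil.IsFieldProlongation θ Θ → Weil.IsFormProlongation Ω ΩA →
          (Weil.IsLocallyHamiltonian Ω θ ↔ Weil.IsLocallyHamiltonianA ΩA Θ) := by
  obtain ⟨ε⟩ := Weil.exists_augmentation hA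
  have hbij : Function.Bijective
      (Weil.VFieldA.along : Weil.VFieldA n M A → Weil.VFieldAlong n M A) :=
    ⟨Weil.VFieldA.along_injective, Weil.VFieldA.along_surjective ε⟩
  refine ⟨hbij, ?_, ?_, fun Θ ΩA hΘ hΩA => Weil.isLocallyHamiltonian_iff ε hΘ hΩA⟩
  · simpa only [Weil.along_eq_prolongAlong_iff] using
      hbij.existsUnique (Weil.prolongAlong A θ)
  · obtain ⟨ΩA, h⟩ := Weil.exists_isFormProlongation ε Ω
    exact ⟨ΩA, h, fun β hβ => Weil.FormA.ext_prolongAlong fun v => (hβ v).trans (h v).symm⟩
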